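/- Let $k$ be an algebraically closed field and let $\mathsf T$ be a piecewise hereditary $k$-linear triangulated category of tame domestic type, i.e. $\mathsf T$ is equivalent, as a $k$-linear triangulated category with suspension $\Sigma$, to the bounded derived category of finite dimensional representations over $k$ of a quiver without oriented cycles whose underlying graph is an extended Dynkin diagram $\tilde A_n$ ($n\ge 1$), $\tilde D_n$ ($n\ge4$), $\tilde E_6$, $\tilde E_7$ or $\tilde E_8$. Let $d\ge 1$ and let $(\mathsf X_i,\mathsf Y_i)$, $i=0,\dots,d-1$, be t-structures on $\mathsf T$, where $\mathsf X_i$ is the aisle, $\Sigma\mathsf X_i\subseteq\mathsf X_i$, $\mathrm{Hom}(\mathsf X_i,\mathsf Y_i)=0$, and each object $s$ has a truncation triangle $s_{\mathsf X_i}\to s\to s_{\mathsf Y_i}\to\Sigma s_{\mathsf X_i}$ with $s_{\mathsf X_i}\in\mathsf X_i$ and $s_{\mathsf Y_i}\in\mathsf Y_i$. Indices of t-structures are read modulo $d$. For an object $t$ of $\mathsf T$, the refined truncation sequence $t\to Y_0\to Y_1\to Y_2\to\cdots$ is constructed as follows. $\alpha_0\colon t\to Y_0:=t_{\mathsf Y_0}$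 is the left truncation. Given $\alpha_n\colon t\to Y_n$, decompose the left truncation $(Y_n)_{\mathsf Y_{n+1}}\cong Y_{n+1}\oplus W_{n+1}$ in such a way that the composition $t\xrightarrow{\alpha_n} Y_n\to (Y_n)_{\mathsf Y_{n+1}}\to W_{n+1}$ is zero, while the composition $\alpha_{n+1}\colon t\to Y_n\to (Y_n)_{\mathsf Y_{n+1}}\to Y_{n+1}$ has nonzero projection to every nonzero direct summand of $Y_{n+1}$; the map $Y_n\to Y_{n+1}$ is the composition of the truncation map with the projection. Let $\mathscr T$ be a standard stable tube of rank $\varrho>1$ in $\mathsf T$: a connected component of the Auslander–Reiten quiver of $\mathsf T$ that is isomorphic, as a translation quiver, to $\mathbb Z A_\infty/(\tau^{\varrho})$ and whose indecomposable objects form a full subcategory of $\mathsf T$ equivalent to the mesh category of that component. We also write $\mathscr T$ for the full subcategory of finite direct sums of these indecomposable objects. Let $t\in\mathscr T$ be indecomposable. Then a refined truncation sequence of $t$ exists, and for every such sequence the following hold. Each $Y_n$ has a decomposition $Y_n\cong Y_n'\oplus Z_n$ with $Y_n'\in\mathscr T$ and such that $Z_n$ has no indecomposable direct summand in $\mathscr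 T$. The sequence of $\mathscr T$-summands $$Y_0'\longrightarrow Y_1'\longrightarrow Y_2'\longrightarrow\cdots ,$$ whose maps are the compositions $Y_n'\hookrightarrow Y_n\to Y_{n+1}\twoheadrightarrow Y_{n+1}'$, stabilises after finitely many steps: there is $N$ such that $Y_n'\to Y_{n+1}'$ is an isomorphism for all $n\ge N$, whatever decompositions are chosen. -/

import Mathlib

open CategoryTheory CategoryTheory.Limits CategoryTheory.Pretriangulated CategoryTheory.Triangulated

universe w v u

noncomputable section

/-! ### Extended Dynkin quivers of type A, D, E and tame domestic type -/

/-- The extended simply-laced Dynkin diagrams. -/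
inductive ExtendedDynkin : Type
  /-- `A n` is the diagram `Ã_{n+1}`, a cycle with `n + 2` vertices (a double edge for `n = 0`). -/
  | A (n : ℕ)
  /-- `D n` is the diagram `D̃_{n+4}`, with `n + 5` vertices. -/
  | D (n : ℕ)
  /-- The diagram `Ẽ₆`. -/
  | E₆
  /-- The diagram `Ẽ₇`. -/
  | E₇
  /-- The diagram `Ẽ₈`. -/
  | E₈

namespace ExtendedDynkin

/-- The number of vertices; the vertices are labelled `0, 1, …`. -/
def numVertices : ExtendedDynkin → ℕ
  | A n => n + 2
  | D n => n + 5
  | E₆ => 7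
  | E₇ => 8
  | E₈ => 9

/-- The list of edges (with repetition for the double edge of `Ã₁`). For `D̃_{n+4}` the vertices
`0 — 1 — ⋯ — (n+2)` form a path, `n+3` is attached to `1` and `n+4` is attached to `n+1`. The
diagrams of type `E` are stars with centre `0`. -/
def edges : ExtendedDynkin → List (ℕ × ℕ)
  | A n => (List.range (n + 2)).map fun i => (i, (i + 1) % (n + 2))
  | D n => (List.range (n + 2)).map (fun i => (i, i + 1)) ++ [(n + 3, 1), (n + 4, n + 1)]
  | E₆ => [(0, 1), (1, 2), (0, 3), (3, 4), (0, 5), (5, 6)]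
  | E₇ => [(0, 1), (1, 2), (2, 3), (0, 4), (4, 5), (5, 6), (0, 7)]
  | E₈ => [(0, 1), (0, 2), (2, 3), (0, 4), (4, 5), (5, 6), (6, 7), (7, 8)]

end ExtendedDynkin

/-- A quiver is of extended simply-laced Dynkin type if it has no oriented cycle and its underlying
graph (with multiplicities) is an extended Dynkin diagram of type `A`, `D` or `E`: `φ` labels the
vertices and `ψ` matches the arrows with the edges. -/
def IsExtendedDynkinQuiver (V : Type) [Quiver.{0} V] : Prop :=
  (∀ (a : V) (p : Quiver.Path a a), p.length = 0) ∧
  ∃ (Δ : ExtendedDynkin) (φ : V ≃ Fin Δ.numVertices)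
    (ψ : (Σ (a : V) (b : V), (a ⟶ b)) ≃ Fin Δ.edges.length),
    ∀ (a b : V) (f : a ⟶ b),
      s(((φ a : Fin _) : ℕ), ((φ b : Fin _) : ℕ)) =
        s((Δ.edges.get (ψ ⟨a, b, f⟩)).1, (Δ.edges.get (ψ ⟨a, b, f⟩)).2)

/-- The `k`-linear abelian category of finite dimensional representations of a quiver. For a finite
quiver without oriented cycles this is the category of finite dimensional modules over its path
algebra. -/
abbrev QuiverRep (k : Type w) [Field k] (V : Type) [Quiver.{0} V] :=
  Paths V ⥤ FGModuleCat.{w} k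

/-- `T` is equivalent, as a `k`-linear triangulated category, to the bounded derived category of the
`k`-linear abelian category `A`. -/
def IsBoundedDerivedCategoryOf (k : Type w) [Field k]
    (T : Type u) [Category.{v} T] [Preadditive T] [Linear k T] [HasZeroObject T] [HasShift T ℤ]
    [∀ n : ℤ, (shiftFunctor T n).Additive] [Pretriangulated T]
    (A : Type*) [Category* A] [Abelian A] [Linear k A] : Prop :=
  letI : HasDerivedCategory A := HasDerivedCategory.standard A
  ∃ (F : T ⥤ (DerivedCategory.TStructure.t (C := A)).bounded.FullSubcategory)
    (_ : F.Additive) (_ : F.CommShift ℤ),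
    F.IsEquivalence ∧ F.IsTriangulated ∧ F.Linear k

/-- Piecewise hereditary `k`-linear triangulated categories of tame domestic type: those that are
triangle equivalent to the bounded derived category of the path algebra of a quiver of extended
simply-laced Dynkin type. -/
def IsPiecewiseTameHereditary (k : Type w) [Field k]
    (T : Type u) [Category.{v} T] [Preadditive T] [Linear k T] [HasZeroObject T] [HasShift T ℤ]
    [∀ n : ℤ, (shiftFunctor T n).Additive] [Pretriangulated T] : Prop :=
  ∃ (V : Type) (_ : Quiver.{0} V), IsExtendedDynkinQuiver V ∧
    IsBoundedDerivedCategoryOf k T (QuiverRep k V)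

/-! ### Auslander–Reiten triangles and standard stable tubes -/

/-- An Auslander–Reiten triangle `X → E → Z → X⟦1⟧`: a distinguished triangle with `X` and `Z`
indecomposable and nonzero connecting morphism, such that every morphism to `Z` that is not a
split epimorphism factors through `E → Z`. -/
structure IsAuslanderReitenTriangle {T : Type u} [Category.{v} T] [Preadditive T] [HasZeroObject T]
    [HasShift T ℤ] [∀ n : ℤ, (shiftFunctor T n).Additive] [Pretriangulated T]
    (Δ : Triangle T) : Prop where
  distinguished : Δ ∈ distTriang T
  indecomposable_left : Indecomposable Δ.obj₁
  indecomposable_right : Indecomposable Δ.obj₃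
  connecting_ne_zero : Δ.mor₃ ≠ 0
  almost_split : ∀ (W : T) (f : W ⟶ Δ.obj₃), ¬ IsSplitEpi f → ∃ g : W ⟶ Δ.obj₂, g ≫ Δ.mor₂ = f

/-- The vertices of the translation quiver `ℤA_∞/(τ^ρ)`. The vertex `⟨i, l⟩` stands for the
indecomposable of length `l + 1` whose quasi-socle is the `i`-th quasi-simple; the translate is
`τ ⟨i + 1, l⟩ = ⟨i, l⟩`. -/
structure TubeVertex (ρ : ℕ) : Type where
  pos : ZMod ρ
  level : ℕ

/-- The arrows of `ℤA_∞/(τ^ρ)`: `up` along the rays, `down` along the corays. -/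
inductive TubeArrow (ρ : ℕ) : TubeVertex ρ → TubeVertex ρ → Type
  | up (i : ZMod ρ) (l : ℕ) : TubeArrow ρ ⟨i, l⟩ ⟨i, l + 1⟩
  | down (i : ZMod ρ) (l : ℕ) : TubeArrow ρ ⟨i, l + 1⟩ ⟨i + 1, l⟩

instance (ρ : ℕ) : Quiver.{0} (TubeVertex ρ) := ⟨TubeArrow ρ⟩

namespace TubeVertex

variable {ρ : ℕ}

/-- The arrow `⟨i, l⟩ ⟶ ⟨i, l + 1⟩`. -/
def up (i : ZMod ρ) (l : ℕ) : (⟨i, l⟩ : TubeVertex ρ) ⟶ ⟨i, l + 1⟩ := TubeArrow.up i l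

/-- The arrow `⟨i, l + 1⟩ ⟶ ⟨i + 1, l⟩`. -/
def down (i : ZMod ρ) (l : ℕ) : (⟨i, l + 1⟩ : TubeVertex ρ) ⟶ ⟨i + 1, l⟩ := TubeArrow.down i l

/-- The path `⟨i, l⟩ ⟶ ⟨i, l + 1⟩ ⟶ ⟨i + 1, l⟩`. -/
def upDown (i : ZMod ρ) (l : ℕ) : Quiver.Path (⟨i, l⟩ : TubeVertex ρ) ⟨i + 1, l⟩ :=
  (up i l).toPath.comp (down i l).toPath

/-- The path `⟨i, l + 1⟩ ⟶ ⟨i + 1, l⟩ ⟶ ⟨i + 1, l + 1⟩`. -/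
def downUp (i : ZMod ρ) (l : ℕ) : Quiver.Path (⟨i, l + 1⟩ : TubeVertex ρ) ⟨i + 1, l + 1⟩ :=
  (down i l).toPath.comp (up (i + 1) l).toPath

/-- The mesh ideal, from `x` to `y`: the two-sided ideal of the `k`-linear path category generated by
the mesh relations `upDown i 0` (at the mouth) and `upDown i (l + 1) + downUp i l`. -/
def meshIdeal (k : Type w) [Field k] (x y : TubeVertex ρ) : Submodule k (Quiver.Path x y →₀ k) :=
  Submodule.span k
    ({r | ∃ (i : ZMod ρ) (p : Quiver.Path x ⟨i, 0⟩) (q : Quiver.Path ⟨i + 1, 0⟩ y),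
        r = Finsupp.single ((p.comp (upDown i 0)).comp q) 1} ∪
      {r | ∃ (i : ZMod ρ) (l : ℕ) (p : Quiver.Path x ⟨i, l + 1⟩)
          (q : Quiver.Path ⟨i + 1, l + 1⟩ y),
        r = Finsupp.single ((p.comp (upDown i (l + 1))).comp q) 1 +
          Finsupp.single ((p.comp (downUp i l)).comp q) 1})

end TubeVertex

/-- A standard stable tube of rank `ρ` in a `k`-linear triangulated category `T`, given by its
indecomposable objects (up to isomorphism) and irreducible morphisms. The fields `not_iso`,
`ar_mouth` and `ar_mesh` say that they form a connected component of the Auslander–Reiten quiver of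
`T` which is isomorphic, as a translation quiver, to `ℤA_∞/(τ^ρ)`: the Auslander–Reiten triangle
ending at a given object determines its translate and all irreducible morphisms to it. The fields
`full` and `kernel` say that the tube is standard: the full subcategory of `T` on these
objects is the mesh category of its Auslander–Reiten quiver. -/
structure StandardStableTube (k : Type w) [Field k]
    (T : Type u) [Category.{v} T] [Preadditive T] [Linear k T] [HasZeroObject T] [HasShift T ℤ]
    [∀ n : ℤ, (shiftFunctor T n).Additive] [Pretriangulated T] (ρ : ℕ) where
  /-- The objects and the irreducible morphisms. -/
  F : TubeVertex ρ ⥤q T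
  not_iso : ∀ x y : TubeVertex ρ, Nonempty (F.obj x ≅ F.obj y) → x = y
  ar_mouth : ∀ i : ZMod ρ, ∃ h : F.obj ⟨i + 1, 0⟩ ⟶ (F.obj ⟨i, 0⟩)⟦(1 : ℤ)⟧,
    IsAuslanderReitenTriangle
      (Triangle.mk (F.map (TubeVertex.up i 0)) (F.map (TubeVertex.down i 0)) h)
  ar_mesh : ∀ (i : ZMod ρ) (l : ℕ), ∃ h : F.obj ⟨i + 1, l + 1⟩ ⟶ (F.obj ⟨i, l + 1⟩)⟦(1 : ℤ)⟧,
    IsAuslanderReitenTriangle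
      (Triangle.mk
        (biprod.lift (F.map (TubeVertex.up i (l + 1))) (F.map (TubeVertex.down i l)))
        (biprod.desc (F.map (TubeVertex.down i (l + 1))) (F.map (TubeVertex.up (i + 1) l))) h)
  full : ∀ x y : TubeVertex ρ, Function.Surjective
    (Finsupp.linearCombination k
      (fun p : Quiver.Path x y => ((Paths.lift F).map p : F.obj x ⟶ F.obj y)))
  kernel : ∀ x y : TubeVertex ρ, LinearMap.ker
    (Finsupp.linearCombination k
      (fun p : Quiver.Path x y => ((Paths.lift F).map p : F.obj x ⟶ F.obj y))) =
        TubeVertex.meshIdeal k x y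

namespace StandardStableTube

variable {k : Type w} [Field k] {T : Type u} [Category.{v} T] [Preadditive T] [Linear k T]
  [HasZeroObject T] [HasShift T ℤ] [∀ n : ℤ, (shiftFunctor T n).Additive] [Pretriangulated T]
  {ρ : ℕ}

/-- The full subcategory of `T` formed by the finite direct sums of indecomposables of the tube. -/
def mem (𝒯 : StandardStableTube k T ρ) : ObjectProperty T := fun X =>
  ∃ (n : ℕ) (x : Fin n → TubeVertex ρ), Nonempty (X ≅ ⨁ fun j => 𝒯.F.obj (x j))

/-- A decomposition `Y ≅ Y' ⊞ Z` where `Y'` is the summand of `Y` lying in the tube: `Y'` lies in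
the tube, and `Z` has no direct summand that is an indecomposable of the tube. -/
structure Splitting (𝒯 : StandardStableTube k T ρ) (Y : T) where
  Y' : T
  Z : T
  iso : Y ≅ Y' ⊞ Z
  mem : 𝒯.mem Y'
  isEmpty_retract : ∀ x : TubeVertex ρ, IsEmpty (Retract (𝒯.F.obj x) Z)

/-- The inclusion of the summand in the tube. -/
def Splitting.ι {𝒯 : StandardStableTube k T ρ} {Y : T} (P : 𝒯.Splitting Y) : P.Y' ⟶ Y :=
  biprod.inl ≫ P.iso.inv

/-- The projection to the summand in the tube. -/
def Splitting.π {𝒯 : StandardStableTube k T ρ} {Y : T} (P : 𝒯.Splitting Y) : Y ⟶ P.Y' :=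
  P.iso.hom ≫ biprod.fst

end StandardStableTube

/-! ### The refined truncation algorithm -/

section Refined

variable {T : Type u} [Category.{v} T] [Preadditive T]
  [HasZeroObject T] [HasShift T ℤ] [∀ n : ℤ, (shiftFunctor T n).Additive] [Pretriangulated T]

/-- `f : A ⟶ B` is the left truncation of `A` for the t-structure `(X, Y)`, with aisle `X` the
objects `≤ 0` and co-aisle `Y` the objects `≥ 1`: it is part of a truncation triangle
`A_X ⟶ A ⟶ B ⟶ A_X⟦1⟧`. -/
def IsLeftTruncation (τ : TStructure T) {A B : T} (f : A ⟶ B) : Prop :=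
  τ.ge 1 B ∧ ∃ (X : T) (g : X ⟶ A) (h : B ⟶ X⟦(1 : ℤ)⟧),
    τ.le 0 X ∧ Triangle.mk g f h ∈ distTriang T

/-- The composite of `α` with the projection to each nonzero direct summand of `Y` is nonzero. -/
def IsNonzeroOnSummands {t Y : T} (α : t ⟶ Y) : Prop :=
  ∀ (S S' : T) (e : Y ≅ S ⊞ S'), ¬ IsZero S → α ≫ e.hom ≫ biprod.fst ≠ 0

/-- A run of the refined truncation algorithm, for the t-structures `τ 0, …, τ (d - 1)` and the
object `t`, yielding the refined truncation sequence `t ⟶ Y 0 ⟶ Y 1 ⟶ ⋯`. Here `α n : t ⟶ Y n`, and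
`Y (n + 1)` is obtained from the left truncation `B` of `Y n` for `τ (n + 1 mod d)` by decomposing
`B ≅ Y (n + 1) ⊞ W` so that the map from `t` is zero to `W` and nonzero on all direct summands of
`Y (n + 1)`. -/
structure RefinedTruncation {d : ℕ} [NeZero d] (τ : Fin d → TStructure T) (t : T) where
  Y : ℕ → T
  α : ∀ n, t ⟶ Y n
  β : ∀ n, Y n ⟶ Y (n + 1)
  init : IsLeftTruncation (τ 0) (α 0)
  step : ∀ n, ∃ (B W : T) (f : Y n ⟶ B) (e : B ≅ Y (n + 1) ⊞ W),
    IsLeftTruncation (τ (Fin.ofNat d (n + 1))) f ∧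
    β n = f ≫ e.hom ≫ biprod.fst ∧
    α n ≫ f ≫ e.hom ≫ biprod.fst = α (n + 1) ∧
    α n ≫ f ≫ e.hom ≫ biprod.snd = 0 ∧
    IsNonzeroOnSummands (α (n + 1))

end Refined

end

/-! A nonzero map from `t` to an indecomposable of the tube is, up to an automorphism of the target,
a basis morphism `kap`. Basis morphisms are indexed by pairs `(a, b)`: `a` steps down corays, at
most the level of `t`, and `b` steps up rays. Let `U n` be the set of pairs whose basis morphism
factors through `α n`. It is an upper set in a strip of finite width, and it decreases with `n`
because `α n ≫ β n = α (n + 1)`. Tube morphisms that pass through an object without summands in the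
tube vanish (`comp_eq_zero`), so `U n` depends only on the tube part of `Y n` and is generated by
pairs coming from its summands (`exists_divisor`).

Once `U n` is constant, every component of `t ⟶ Y n'` factors through `t ⟶ Y (n + 1)'`. These maps
are nonzero on all summands, hence left minimal (`isIso_of_isNonzeroOnSummands`), so `Y n' ⟶ Y (n +
1)'` and the map back compose to isomorphisms in both orders.

A decreasing chain of such upper sets could still escape to infinity along a ray. Periodicity of
co-aisles prevents this: a co-aisle containing a tube object of length greater than `ρ` contains all
objects on its ray whose length is a multiple of `ρ` (`ge_one_mul_rank`). A fixed object of this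
kind lies in all co-aisles involved, and factorisations to it survive each truncation
(`RefinedTruncation.exists_factor`). The rest is the combinatorics of `exists_stable_upper_sets`.

Two tools carry this. Standardness makes Hom spaces inside the tube explicit (`ev_congr`,
`exists_coeff`). Auslander–Reiten triangles make the rectangles of the tube weak pullbacks for test
objects anywhere in `T`, which transports orthogonality to an aisle from one tube object to another.
-/

/-! ### An additive size on the derived category -/

theorem finrank_eq_add_of_iso_biprod {k : Type w} [Field k] {C : Type*} [Category* C]
    [Preadditive C] [HasBinaryBiproducts C] (G : C ⥤ FGModuleCat.{w} k) [G.Additive]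
    {X Y Z : C} (e : X ≅ Y ⊞ Z) :
    Module.finrank k (G.obj X) = Module.finrank k (G.obj Y) + Module.finrank k (G.obj Z) := by
  let G' := G ⋙ forget₂ (FGModuleCat k) (ModuleCat k)
  have := preservesBinaryBiproducts_of_preservesBiproducts G'
  have e' : G'.obj X ≅ ModuleCat.of k (G'.obj Y × G'.obj Z) :=
    G'.mapIso e ≪≫ G'.mapBiprod Y Z ≪≫ ModuleCat.biprodIsoProd _ _
  have h := e'.toLinearEquiv.finrank_eq
  have : Module.Finite k (G'.obj Y) := inferInstanceAs (Module.Finite k (G.obj Y))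
  have : Module.Finite k (G'.obj Z) := inferInstanceAs (Module.Finite k (G.obj Z))
  exact h.trans Module.finrank_prod

theorem FGModuleCat.isZero_of_finrank_eq_zero {k : Type w} [Field k] (M : FGModuleCat.{w} k)
    (h : Module.finrank k M = 0) : IsZero M := by
  have : Subsingleton M := Module.finrank_zero_iff.mp h
  rw [IsZero.iff_id_eq_zero]
  ext x
  exact Subsingleton.elim _ _

/-- Homology detects isomorphisms, and here it makes the zero endomorphism one. -/
theorem DerivedCategory.isZero_of_isZero_homology {A : Type*} [Category* A] [Abelian A]
    [HasDerivedCategory A] (X : DerivedCategory A)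
    (h : ∀ i, IsZero ((DerivedCategory.homologyFunctor A i).obj X)) : IsZero X := by
  have hi : IsIso (0 : X ⟶ X) := by
    rw [DerivedCategory.isIso_iff]
    intro i
    exact (h i).isIso (h i) _
  rw [IsZero.iff_id_eq_zero]
  rw [← IsIso.hom_inv_id (0 : X ⟶ X), zero_comp]

/-- A category of tame domestic type carries an additive size: the total dimension of the
cohomology. -/
theorem IsPiecewiseTameHereditary.exists_size {k : Type w} [Field k]
    {T : Type u} [Category.{v} T] [Preadditive T] [Linear k T] [HasZeroObject T] [HasShift T ℤ]
    [∀ n : ℤ, (shiftFunctor T n).Additive] [Pretriangulated T]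
    (hT : IsPiecewiseTameHereditary k T) :
    ∃ size : T → ℕ, (∀ X Y Z : T, (X ≅ Y ⊞ Z) → size X = size Y + size Z) ∧
      ∀ X, size X = 0 → IsZero X := by
  obtain ⟨V, _, ⟨-, Δ, φ, -⟩, hF⟩ := hT
  let _ : HasDerivedCategory (QuiverRep k V) := HasDerivedCategory.standard _
  obtain ⟨F, _, _, hF, -⟩ := hF
  have : Fintype V := Fintype.ofEquiv _ φ.symm
  let H (i : ℤ) : T ⥤ QuiverRep k V :=
    F ⋙ ObjectProperty.ι _ ⋙ DerivedCategory.homologyFunctor (QuiverRep k V) i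
  let G (i : ℤ) (x : V) : T ⥤ FGModuleCat k := H i ⋙ (evaluation (Paths V) (FGModuleCat k)).obj x
  have hH (i : ℤ) : (H i).Additive := inferInstance
  have hG (i : ℤ) (x : V) : (G i x).Additive :=
    ⟨fun {X Y f g} => congrArg (fun h => h.app x) ((H i).map_add (f := f) (g := g))⟩
  let s (i : ℤ) (X : T) : ℕ := ∑ x : V, Module.finrank k ((G i x).obj X)
  have hs0 (i : ℤ) (X : T) : s i X = 0 ↔ IsZero ((H i).obj X) := by
    simp only [s, Finset.sum_eq_zero_iff, Finset.mem_univ, true_imp_iff]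
    constructor
    · intro h
      rw [Functor.isZero_iff]
      exact fun x => FGModuleCat.isZero_of_finrank_eq_zero _ (h x)
    · intro h x
      have hz : IsZero ((G i x).obj X) := (Functor.isZero_iff _).mp h x
      have : Subsingleton ((G i x).obj X) :=
        ⟨fun a b => by
          have h0 := congrArg (fun f => f.hom.hom) (hz.eq_of_src (𝟙 _) 0)
          exact (LinearMap.congr_fun h0 a).trans (LinearMap.congr_fun h0 b).symm⟩
      exact Module.finrank_zero_of_subsingleton
  -- Boundedness of `F.obj X` leaves finitely many degrees, so the `finsum` below is a genuine sum.
  have hfin (X : T) : (Function.support fun i => s i X).Finite := by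
    obtain ⟨⟨a, ha⟩, ⟨b, hb⟩⟩ := (F.obj X).property
    refine (Set.finite_Icc a b).subset fun i hi => ?_
    by_contra hab
    refine hi ((hs0 i X).mpr ?_)
    rw [Set.mem_Icc, not_and_or, not_le, not_le] at hab
    rcases hab with hab | hab
    · exact DerivedCategory.isZero_of_isGE _ _ _ hab (hX := ha)
    · exact DerivedCategory.isZero_of_isLE _ _ _ hab (hX := hb)
  refine ⟨fun X => ∑ᶠ i, s i X, fun X Y Z e => ?_, fun X hX => ?_⟩
  · rw [← finsum_add_distrib (hfin Y) (hfin Z)]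
    refine finsum_congr fun i => ?_
    rw [← Finset.sum_add_distrib]
    exact Finset.sum_congr rfl fun x _ => finrank_eq_add_of_iso_biprod (G i x) e
  · have h0 (i : ℤ) : s i X = 0 := by
      by_contra hi
      change ∑ᶠ i, s i X = 0 at hX
      rw [finsum_eq_sum _ (hfin X), Finset.sum_eq_zero_iff] at hX
      exact hi (hX i ((hfin X).mem_toFinset.mpr hi))
    have hz : IsZero (F.obj X).obj :=
      DerivedCategory.isZero_of_isZero_homology _ fun i => (hs0 i X).mp (h0 i)
    rw [IsZero.iff_id_eq_zero]
    apply F.map_injective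
    ext
    exact hz.eq_of_src _ _

/-! ### Combinatorics of paths in the tube -/

namespace TubeVertex

variable {ρ : ℕ}

/-- Whether an arrow lies on a coray. -/
def arrowDowns {x y : TubeVertex ρ} : (x ⟶ y) → ℕ
  | .up _ _ => 0
  | .down _ _ => 1

/-- The arrow `⟨i, l + 1⟩ ⟶ ⟨i + 1, l⟩` has sign `(-1) ^ l`, arrows on rays have sign `1`. -/
def arrowSign {x y : TubeVertex ρ} : (x ⟶ y) → ℤ
  | .up _ _ => 1
  | .down _ l => (-1) ^ l

/-- The number of arrows of a path lying on corays. -/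
def downs {x : TubeVertex ρ} : ∀ {y : TubeVertex ρ}, Quiver.Path x y → ℕ
  | _, .nil => 0
  | _, .cons p e => downs p + arrowDowns e

/-- The product of the signs of the arrows of a path. -/
def sign {x : TubeVertex ρ} : ∀ {y : TubeVertex ρ}, Quiver.Path x y → ℤ
  | _, .nil => 1
  | _, .cons p e => sign p * arrowSign e

theorem downs_comp {x y z : TubeVertex ρ} (p : Quiver.Path x y) (q : Quiver.Path y z) :
    downs (p.comp q) = downs p + downs q := by
  induction q with
  | nil => rfl
  | cons q e ih => exact (congrArg (· + arrowDowns e) ih).trans (add_assoc _ _ _)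

theorem sign_comp {x y z : TubeVertex ρ} (p : Quiver.Path x y) (q : Quiver.Path y z) :
    sign (p.comp q) = sign p * sign q := by
  induction q with
  | nil => exact (mul_one (sign p)).symm
  | cons q e ih => exact (congrArg (· * arrowSign e) ih).trans (mul_assoc _ _ _)

theorem sign_mul_self {x y : TubeVertex ρ} (p : Quiver.Path x y) : sign p * sign p = 1 := by
  induction p with
  | nil => rfl
  | cons p e ih =>
    have he : arrowSign e * arrowSign e = 1 := by
      rcases e with ⟨i, l⟩ | ⟨i, l⟩
      · rfl
      · change (-1 : ℤ) ^ l * (-1) ^ l = 1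
        rw [← mul_pow]; simp
    change sign p * arrowSign e * (sign p * arrowSign e) = 1
    rw [mul_mul_mul_comm, ih, he, one_mul]

/-- Up arrows raise the level by one and down arrows lower it by one. For fixed ends the number of
downs therefore determines the length, which allows inductions on length that compare two paths. -/
theorem length_eq {x y : TubeVertex ρ} (p : Quiver.Path x y) :
    y.level + 2 * downs p = x.level + p.length := by
  induction p with
  | nil => rfl
  | cons p e ih =>
    rcases e with ⟨i, l⟩ | ⟨i, l⟩
    · change l + 1 + 2 * downs p = x.level + (p.length + 1)
      change l + 2 * downs p = _ at ih
      omega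
    · change l + 2 * (downs p + 1) = x.level + (p.length + 1)
      change l + 1 + 2 * downs p = _ at ih
      omega

theorem downs_le_length {x y : TubeVertex ρ} (p : Quiver.Path x y) : downs p ≤ p.length := by
  induction p with
  | nil => rfl
  | cons p e ih =>
    rcases e with ⟨i, l⟩ | ⟨i, l⟩
    · exact ih.trans (Nat.le_succ _)
    · exact Nat.succ_le_succ ih

theorem pos_eq {x y : TubeVertex ρ} (p : Quiver.Path x y) : y.pos = x.pos + downs p := by
  induction p with
  | nil => simp [downs]
  | cons p e ih =>
    rcases e with ⟨i, l⟩ | ⟨i, l⟩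
    · exact ih
    · change i + 1 = x.pos + ((downs p + 1 : ℕ) : ZMod ρ)
      rw [Nat.cast_succ, ← add_assoc, ← ih]

/-- There are paths from `x` to `y` with `a` arrows along corays which do not vanish in the mesh
category. -/
structure Reach (x y : TubeVertex ρ) (a : ℕ) : Prop where
  pos : y.pos = x.pos + a
  le : a ≤ x.level
  le' : x.level ≤ y.level + a

theorem Reach.of_path {x y : TubeVertex ρ} (p : Quiver.Path x y) (h : downs p ≤ x.level) :
    Reach x y (downs p) :=
  ⟨pos_eq p, h, by have := length_eq p; have := downs_le_length p; omega⟩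

theorem Reach.exists_path {x y : TubeVertex ρ} {a : ℕ} (h : Reach x y a) :
    ∃ p : Quiver.Path x y, downs p = a := by
  obtain ⟨i, l⟩ := x
  obtain ⟨j, m⟩ := y
  obtain ⟨h₁, h₂, h₃⟩ := h
  dsimp only at h₁ h₂ h₃
  induction a generalizing j m with
  | zero =>
    obtain ⟨r, rfl⟩ : ∃ r, m = l + r := ⟨m - l, by omega⟩
    obtain rfl : j = i := by simpa using h₁
    clear h₁ h₂ h₃
    induction r with
    | zero => exact ⟨.nil, rfl⟩
    | succ r ih =>
      obtain ⟨p, hp⟩ := ih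
      exact ⟨p.cons (up j (l + r)), hp⟩
  | succ a ih =>
    obtain ⟨p, hp⟩ := ih (i + a) (m + 1) rfl (by omega) (by omega)
    obtain rfl : j = i + a + 1 := by rw [h₁]; push_cast; ring
    exact ⟨p.cons (down _ m), congrArg (· + 1) hp⟩

/-- The endpoint is a free variable `z` so that `cases` applies; writing its position as `i + 1`
names the source of a final down arrow. -/
theorem last_arrow {x z : TubeVertex ρ} (q : Quiver.Path x z) {n : ℕ} (hn : q.length = n + 1)
    {i : ZMod ρ} {l : ℕ} (hz : ⟨i + 1, l⟩ = z) :
    (∃ (m : ℕ) (q' : Quiver.Path x ⟨i + 1, m⟩) (h : ⟨i + 1, m + 1⟩ = z),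
      q = h ▸ q'.cons (up (i + 1) m)) ∨
    ∃ q' : Quiver.Path x ⟨i, l + 1⟩, q = hz ▸ q'.cons (down i l) := by
  cases q with
  | nil => cases hn
  | cons q e =>
    rcases e with ⟨j, m⟩ | ⟨j, m⟩
    · obtain rfl : i + 1 = j := congrArg pos hz
      exact Or.inl ⟨m, q, rfl, rfl⟩
    · obtain rfl : i = j := add_right_cancel (congrArg pos hz)
      obtain rfl : l = m := congrArg level hz
      exact Or.inr ⟨q, rfl⟩

theorem reach_self (x : TubeVertex ρ) : Reach x x 0 := ⟨by simp, by simp, by simp⟩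

theorem Reach.trans {x y z : TubeVertex ρ} {a b : ℕ} (h : Reach x y a) (h' : Reach y z b)
    (hab : a + b ≤ x.level) : Reach x z (a + b) :=
  ⟨by rw [h'.pos, h.pos]; push_cast; ring, hab, by have := h.le'; have := h'.le'; omega⟩

end TubeVertex

/-! ### Morphisms given by paths -/

namespace StandardStableTube

open TubeVertex

variable {k : Type w} [Field k] {T : Type u} [Category.{v} T] [Preadditive T] [Linear k T]
  [HasZeroObject T] [HasShift T ℤ] [∀ n : ℤ, (shiftFunctor T n).Additive] [Pretriangulated T]
  {ρ : ℕ} (𝒯 : StandardStableTube k T ρ)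

/-- The morphism given by an arrow, with the sign that makes the mesh relations commutative. -/
def evArrow {x y : TubeVertex ρ} (e : x ⟶ y) : 𝒯.F.obj x ⟶ 𝒯.F.obj y :=
  arrowSign e • 𝒯.F.map e

/-- The morphism given by a path, with the sign that makes the mesh relations commutative. -/
def ev {x : TubeVertex ρ} : ∀ {y : TubeVertex ρ}, Quiver.Path x y → (𝒯.F.obj x ⟶ 𝒯.F.obj y)
  | _, .nil => 𝟙 _
  | _, .cons p e => ev p ≫ 𝒯.evArrow e

theorem ev_comp {x y z : TubeVertex ρ} (p : Quiver.Path x y) (q : Quiver.Path y z) :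
    𝒯.ev (p.comp q) = 𝒯.ev p ≫ 𝒯.ev q := by
  induction q with
  | nil => exact (Category.comp_id _).symm
  | cons q e ih => exact (congrArg (· ≫ 𝒯.evArrow e) ih).trans (Category.assoc _ _ _)

/-- The morphism given by a path. -/
def pathMap {x y : TubeVertex ρ} (p : Quiver.Path x y) : 𝒯.F.obj x ⟶ 𝒯.F.obj y :=
  (Paths.lift 𝒯.F).map p

theorem ev_eq_sign_smul {x y : TubeVertex ρ} (p : Quiver.Path x y) :
    𝒯.ev p = sign p • 𝒯.pathMap p := by
  induction p with
  | nil => exact (one_smul ℤ (𝟙 (𝒯.F.obj x))).symm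
  | cons p e ih =>
    have h : 𝒯.pathMap (p.cons e) = 𝒯.pathMap p ≫ 𝒯.F.map e := rfl
    rw [h]
    change 𝒯.ev p ≫ (arrowSign e • 𝒯.F.map e) = (sign p * arrowSign e) • _
    rw [ih, Preadditive.comp_zsmul, Preadditive.zsmul_comp, smul_smul, mul_comm]

theorem pathMap_eq_sign_smul {x y : TubeVertex ρ} (p : Quiver.Path x y) :
    𝒯.pathMap p = sign p • 𝒯.ev p := by
  rw [ev_eq_sign_smul, smul_smul, sign_mul_self, one_smul]

theorem ev_up_down_zero (i : ZMod ρ) :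
    𝒯.evArrow (up i 0) ≫ 𝒯.evArrow (down i 0) = 0 := by
  obtain ⟨h, H⟩ := 𝒯.ar_mouth i
  have h0 : 𝒯.F.map (up i 0) ≫ 𝒯.F.map (down i 0) = 0 :=
    comp_distTriang_mor_zero₁₂ _ H.distinguished
  simp only [evArrow, Preadditive.comp_zsmul, Preadditive.zsmul_comp, h0, smul_zero]

theorem ev_up_down (i : ZMod ρ) (l : ℕ) :
    𝒯.evArrow (up i (l + 1)) ≫ 𝒯.evArrow (down i (l + 1)) =
      𝒯.evArrow (down i l) ≫ 𝒯.evArrow (up (i + 1) l) := by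
  obtain ⟨h, H⟩ := 𝒯.ar_mesh i l
  have h0 : biprod.lift (𝒯.F.map (up i (l + 1))) (𝒯.F.map (down i l)) ≫
      biprod.desc (𝒯.F.map (down i (l + 1))) (𝒯.F.map (up (i + 1) l)) = 0 :=
    comp_distTriang_mor_zero₁₂ _ H.distinguished
  rw [biprod.lift_desc] at h0
  have h1 := eq_neg_of_add_eq_zero_left h0
  simp only [evArrow, Preadditive.comp_zsmul, Preadditive.zsmul_comp, arrowSign, up, down] at h1 ⊢
  rw [h1, pow_succ]
  simp

/-- Paths with the same number of arrows on corays give the same morphism. -/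
theorem ev_congr {x y : TubeVertex ρ} (p q : Quiver.Path x y)
    (h : downs p = downs q) (hx : downs p ≤ x.level) : 𝒯.ev p = 𝒯.ev q := by
  obtain ⟨n, hn⟩ : ∃ n, p.length = n := ⟨_, rfl⟩
  induction n generalizing y with
  | zero =>
    have hq : q.length = 0 := by have := length_eq p; have := length_eq q; omega
    cases p with
    | nil => cases q with
      | nil => rfl
      | cons q e => cases hq
    | cons p e => cases hn
  | succ n ih =>
    -- If one path ends with an up arrow and the other with a down arrow, both can be rerouted by
    -- induction through the opposite corner `⟨i, l + 1⟩` of the last mesh, which commutes.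
    have mixed : ∀ (i : ZMod ρ) (l : ℕ) (p : Quiver.Path x ⟨i + 1, l⟩)
        (q : Quiver.Path x ⟨i, l + 2⟩), p.length = n → downs p = downs q + 1 →
        downs p ≤ x.level →
        𝒯.ev (p.cons (up (i + 1) l)) = 𝒯.ev (q.cons (down i (l + 1))) := by
      intro i l p q hn h hx
      have hp := length_eq p
      have hq := length_eq q
      have hp' := downs_le_length p
      dsimp only at hp hq
      obtain ⟨r, hr⟩ := (⟨pos_eq q, by omega, by dsimp only; omega⟩ :
        Reach x ⟨i, l + 1⟩ (downs q)).exists_path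
      have h1 := ih p (r.cons (down i l)) (h.trans (congrArg (· + 1) hr.symm)) hx hn
      have h2 := ih q (r.cons (up i (l + 1))) hr.symm (by omega) (by omega)
      change 𝒯.ev p ≫ _ = 𝒯.ev q ≫ _
      rw [h1, h2]
      change (𝒯.ev r ≫ _) ≫ _ = (𝒯.ev r ≫ _) ≫ _
      rw [Category.assoc, Category.assoc, ev_up_down]
    obtain ⟨j, m⟩ := y
    obtain ⟨i, rfl⟩ : ∃ i, j = i + 1 := ⟨j - 1, by ring⟩
    have hq : q.length = n + 1 := by have := length_eq p; have := length_eq q; omega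
    rcases last_arrow p hn rfl with ⟨l, p', hl, hp'⟩ | ⟨p', hp'⟩ <;>
    rcases last_arrow q hq rfl with ⟨l', q', hl', hq'⟩ | ⟨q', hq'⟩
    · obtain rfl : l + 1 = m := congrArg level hl
      obtain rfl : l' = l := Nat.succ_injective (congrArg level hl')
      subst hp' hq'
      exact congrArg (· ≫ 𝒯.evArrow (up (i + 1) l')) (ih p' q' h hx (Nat.succ_injective hn))
    · obtain rfl : l + 1 = m := congrArg level hl
      subst hp' hq'
      exact mixed i l p' q' (Nat.succ_injective hn) h hx
    · obtain rfl : l' + 1 = m := congrArg level hl'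
      subst hp' hq'
      exact (mixed i l' q' p' (Nat.succ_injective hq) h.symm (h ▸ hx)).symm
    · subst hp' hq'
      exact congrArg (· ≫ 𝒯.evArrow (down i m)) (ih p' q' (Nat.succ_injective h)
        (Nat.le_of_succ_le hx) (Nat.succ_injective hn))

theorem ev_eq_zero {x y : TubeVertex ρ} (p : Quiver.Path x y) (hx : x.level < downs p) :
    𝒯.ev p = 0 := by
  obtain ⟨n, hn⟩ : ∃ n, p.length = n := ⟨_, rfl⟩
  induction n generalizing y with
  | zero => have := downs_le_length p; omega
  | succ n ih =>
    obtain ⟨j, m⟩ := y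
    obtain ⟨i, rfl⟩ : ∃ i, j = i + 1 := ⟨j - 1, by ring⟩
    rcases last_arrow p hn rfl with ⟨l, p', hl, hp'⟩ | ⟨p', hp'⟩
    · obtain rfl : l + 1 = m := congrArg level hl
      subst hp'
      exact (congrArg (· ≫ 𝒯.evArrow (up (i + 1) l)) (ih p' hx (Nat.succ_injective hn))).trans
        zero_comp
    · subst hp'
      change x.level < downs p' + 1 at hx
      change p'.length + 1 = n + 1 at hn
      change 𝒯.ev p' ≫ 𝒯.evArrow (down i m) = 0
      by_cases h : x.level < downs p'
      · rw [ih p' h (by omega), zero_comp]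
      · obtain ⟨r, hr⟩ := (⟨pos_eq p', by omega, by dsimp only; omega⟩ :
          Reach x ⟨i, m⟩ (downs p')).exists_path
        -- Rerouting makes the path end with up then down. At the mouth this is zero; elsewhere the
        -- mesh exchanges the two arrows and the surplus down arrow occurs in a shorter path.
        rw [𝒯.ev_congr p' (r.cons (up i m)) hr.symm (by omega)]
        change (𝒯.ev r ≫ _) ≫ _ = 0
        rw [Category.assoc]
        cases m with
        | zero => rw [ev_up_down_zero, comp_zero]
        | succ m =>
          have hl1 := length_eq p'
          have hl2 := length_eq r
          dsimp only at hl1 hl2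
          have h0 := ih (r.cons (down i m)) (by change _ < downs r + 1; omega)
            (by change r.length + 1 = n; omega)
          change 𝒯.ev r ≫ 𝒯.evArrow (down i m) = 0 at h0
          rw [ev_up_down, reassoc_of% h0, zero_comp]

end StandardStableTube

/-! ### Coefficient functionals on the mesh category -/

namespace TubeVertex

variable {ρ : ℕ} {k : Type w} [Field k]

/-- The functional on the path category which reads off the coefficient of the paths with `a`
arrows on corays. -/
noncomputable def pathCoeff (k : Type w) [Field k] (x y : TubeVertex ρ) (a : ℕ) :
    (Quiver.Path x y →₀ k) →ₗ[k] k :=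
  Finsupp.linearCombination k fun p => if downs p = a then (sign p : k) else 0

theorem pathCoeff_single (x y : TubeVertex ρ) (a : ℕ) (p : Quiver.Path x y) :
    pathCoeff k x y a (Finsupp.single p 1) = if downs p = a then (sign p : k) else 0 := by
  simp [pathCoeff]

/-- A path through a mouth relation has already used `x.level` downs on reaching level zero, so it
has more than `a` in total. In the other relations the two paths have equally many downs and
opposite signs. -/
theorem meshIdeal_le_ker_pathCoeff (x y : TubeVertex ρ) {a : ℕ} (ha : a ≤ x.level) :
    meshIdeal k x y ≤ LinearMap.ker (pathCoeff k x y a) := by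
  rw [meshIdeal, Submodule.span_le]
  rintro r (⟨i, p, q, rfl⟩ | ⟨i, l, p, q, rfl⟩)
  · rw [SetLike.mem_coe, LinearMap.mem_ker, pathCoeff_single, if_neg]
    have h1 := length_eq p
    have h2 := downs_le_length p
    have h3 : downs (upDown i 0) = 1 := rfl
    rw [downs_comp, downs_comp, h3]
    dsimp only at h1
    omega
  · rw [SetLike.mem_coe, LinearMap.mem_ker, map_add, pathCoeff_single, pathCoeff_single]
    have h1 : downs (upDown i (l + 1)) = 1 := rfl
    have h2 : downs (downUp i l) = 1 := rfl
    have h3 : sign (upDown i (l + 1)) = 1 * 1 * (-1) ^ (l + 1) := rfl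
    have h4 : sign (downUp i l) = 1 * (-1) ^ l * 1 := rfl
    simp only [downs_comp, sign_comp, h1, h2, h3, h4]
    split_ifs
    · push_cast
      ring
    · exact add_zero 0

end TubeVertex

/-! ### Basis morphisms and the radical filtration -/

namespace StandardStableTube

open TubeVertex

variable {k : Type w} [Field k] {T : Type u} [Category.{v} T] [Preadditive T] [Linear k T]
  [HasZeroObject T] [HasShift T ℤ] [∀ n : ℤ, (shiftFunctor T n).Additive] [Pretriangulated T]
  {ρ : ℕ} (𝒯 : StandardStableTube k T ρ)

open Classical in
/-- The basis morphism from `x` to `y` which is given by the paths with `a` arrows on corays; zero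
if there is no such nonvanishing path. -/
noncomputable def kap (x y : TubeVertex ρ) (a : ℕ) : 𝒯.F.obj x ⟶ 𝒯.F.obj y :=
  if h : Reach x y a then 𝒯.ev h.exists_path.choose else 0

theorem kap_eq_zero {x y : TubeVertex ρ} {a : ℕ} (h : ¬ Reach x y a) : 𝒯.kap x y a = 0 :=
  dif_neg h

theorem ev_eq_kap {x y : TubeVertex ρ} (p : Quiver.Path x y) : 𝒯.ev p = 𝒯.kap x y (downs p) := by
  by_cases h : Reach x y (downs p)
  · rw [kap, dif_pos h]
    exact 𝒯.ev_congr _ _ h.exists_path.choose_spec.symm h.le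
  · rw [kap_eq_zero _ h, ev_eq_zero]
    by_contra hp
    exact h (Reach.of_path p (not_lt.mp hp))

/-- No bound on `a + b` is needed: when the composite path vanishes, the right side is zero by
convention. -/
theorem kap_comp {x y z : TubeVertex ρ} {a b : ℕ} (h : Reach x y a) (h' : Reach y z b) :
    𝒯.kap x y a ≫ 𝒯.kap y z b = 𝒯.kap x z (a + b) := by
  obtain ⟨p, rfl⟩ := h.exists_path
  obtain ⟨q, rfl⟩ := h'.exists_path
  rw [← ev_eq_kap, ← ev_eq_kap, ← ev_comp, ev_eq_kap, downs_comp]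

@[simp] theorem kap_self (x : TubeVertex ρ) : 𝒯.kap x x 0 = 𝟙 _ :=
  (𝒯.ev_eq_kap (Quiver.Path.nil : Quiver.Path x x)).symm

theorem evArrow_up (i : ZMod ρ) (l : ℕ) :
    𝒯.evArrow (up i l) = 𝒯.kap ⟨i, l⟩ ⟨i, l + 1⟩ 0 :=
  (Category.id_comp _).symm.trans (𝒯.ev_eq_kap (up i l).toPath)

theorem evArrow_down (i : ZMod ρ) (l : ℕ) :
    𝒯.evArrow (down i l) = 𝒯.kap ⟨i, l + 1⟩ ⟨i + 1, l⟩ 1 :=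
  (Category.id_comp _).symm.trans (𝒯.ev_eq_kap (down i l).toPath)

theorem mem_span_kap {x y : TubeVertex ρ} (f : 𝒯.F.obj x ⟶ 𝒯.F.obj y) :
    f ∈ Submodule.span k {g | ∃ a, Reach x y a ∧ g = 𝒯.kap x y a} := by
  obtain ⟨r, rfl⟩ := 𝒯.full x y f
  change Finsupp.linearCombination k 𝒯.pathMap r ∈ _
  rw [Finsupp.linearCombination_apply]
  refine Submodule.sum_mem _ fun p _ => Submodule.smul_mem _ _ ?_
  rw [pathMap_eq_sign_smul, ev_eq_kap]
  refine zsmul_mem ?_ _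
  by_cases h : Reach x y (downs p)
  · exact Submodule.subset_span ⟨_, h, rfl⟩
  · rw [kap_eq_zero _ h]
    exact zero_mem _

/-- The basis morphisms are linearly independent. -/
theorem exists_coeff {x y : TubeVertex ρ} {a : ℕ} (h : Reach x y a) :
    ∃ c : (𝒯.F.obj x ⟶ 𝒯.F.obj y) →ₗ[k] k, c (𝒯.kap x y a) = 1 ∧
      ∀ b ≠ a, c (𝒯.kap x y b) = 0 := by
  let π := Finsupp.linearCombination k (fun p : Quiver.Path x y => 𝒯.pathMap p)
  have hπ : LinearMap.ker π = meshIdeal k x y := 𝒯.kernel x y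
  let c := ((LinearMap.ker π).liftQ (pathCoeff k x y a)
    (hπ.le.trans (meshIdeal_le_ker_pathCoeff x y h.le))).comp
    (π.quotKerEquivOfSurjective (𝒯.full x y)).symm.toLinearMap
  have hc (p : Quiver.Path x y) : c (𝒯.pathMap p) = if downs p = a then (sign p : k) else 0 := by
    have h1 : 𝒯.pathMap p = π.quotKerEquivOfSurjective (𝒯.full x y)
        (Submodule.Quotient.mk (Finsupp.single p 1)) := by
      have h2 : π (Finsupp.single p 1) = 𝒯.pathMap p := by simp [π]
      exact h2.symm
    rw [h1]
    simp [c, pathCoeff_single]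
  have hc' (p : Quiver.Path x y) : c (𝒯.ev p) = if downs p = a then 1 else 0 := by
    rw [ev_eq_sign_smul, map_zsmul, hc]
    split_ifs
    · rw [zsmul_eq_mul]
      exact_mod_cast congrArg (Int.cast (R := k)) (sign_mul_self p)
    · exact smul_zero _
  refine ⟨c, ?_, fun b hb => ?_⟩
  · obtain ⟨p, rfl⟩ := h.exists_path
    rw [← ev_eq_kap, hc', if_pos rfl]
  · by_cases h' : Reach x y b
    · obtain ⟨p, rfl⟩ := h'.exists_path
      rw [← ev_eq_kap, hc', if_neg hb]
    · rw [kap_eq_zero _ h', map_zero]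

theorem kap_ne_zero {x y : TubeVertex ρ} {a : ℕ} (h : Reach x y a) : 𝒯.kap x y a ≠ 0 := by
  obtain ⟨c, hc, -⟩ := 𝒯.exists_coeff h
  intro h0
  rw [h0, map_zero] at hc
  exact zero_ne_one hc

theorem not_isZero_obj (x : TubeVertex ρ) : ¬ IsZero (𝒯.F.obj x) := fun h =>
  𝒯.kap_ne_zero (reach_self x) (h.eq_of_src _ _)

/-- The morphisms from `x` to `y` which are combinations of paths of length at least `n`. -/
def filt (n : ℕ) (x y : TubeVertex ρ) : Submodule k (𝒯.F.obj x ⟶ 𝒯.F.obj y) :=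
  Submodule.span k {g | ∃ a, Reach x y a ∧ x.level + n ≤ y.level + 2 * a ∧ g = 𝒯.kap x y a}

theorem comp_mem_filt {m n : ℕ} {x y z : TubeVertex ρ} {f : 𝒯.F.obj x ⟶ 𝒯.F.obj y}
    {g : 𝒯.F.obj y ⟶ 𝒯.F.obj z} (hf : f ∈ 𝒯.filt m x y) (hg : g ∈ 𝒯.filt n y z) :
    f ≫ g ∈ 𝒯.filt (m + n) x z := by
  induction hf using Submodule.span_induction with
  | zero => rw [zero_comp]; exact zero_mem _
  | add f f' _ _ h h' => rw [Preadditive.add_comp]; exact add_mem h h'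
  | smul c f _ h => rw [Linear.smul_comp]; exact Submodule.smul_mem _ _ h
  | mem f hf =>
    obtain ⟨a, ha, ham, rfl⟩ := hf
    induction hg using Submodule.span_induction with
    | zero => rw [comp_zero]; exact zero_mem _
    | add f f' _ _ h h' => rw [Preadditive.comp_add]; exact add_mem h h'
    | smul c f _ h => rw [Linear.comp_smul]; exact Submodule.smul_mem _ _ h
    | mem g hg =>
      obtain ⟨b, hb, hbn, rfl⟩ := hg
      rw [kap_comp _ ha hb]
      by_cases h : Reach x z (a + b)
      · exact Submodule.subset_span ⟨_, h, by omega, rfl⟩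
      · rw [kap_eq_zero _ h]
        exact zero_mem _

/-- A nonvanishing path has at most `x.level` downs and at most `y.level` ups. -/
theorem eq_zero_of_mem_filt {n : ℕ} {x y : TubeVertex ρ} (hn : x.level + y.level < n)
    {f : 𝒯.F.obj x ⟶ 𝒯.F.obj y} (hf : f ∈ 𝒯.filt n x y) : f = 0 := by
  induction hf using Submodule.span_induction with
  | zero => rfl
  | add f f' _ _ h h' => rw [h, h', add_zero]
  | smul c f _ h => rw [h, smul_zero]
  | mem f hf =>
    obtain ⟨a, ha, ham, rfl⟩ := hf
    have := ha.le
    omega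

/-- Powers of `r` go ever deeper into the filtration, so `r` is nilpotent, and it commutes with
scalars. -/
theorem isIso_smul_add {x : TubeVertex ρ} {c : k} (hc : c ≠ 0) {r : 𝒯.F.obj x ⟶ 𝒯.F.obj x}
    (hr : r ∈ 𝒯.filt 1 x x) : IsIso (c • 𝟙 (𝒯.F.obj x) + r) := by
  have hpow (n : ℕ) : ((End.of r) ^ (n + 1) : End (𝒯.F.obj x)) ∈ 𝒯.filt (n + 1) x x := by
    induction n with
    | zero => rw [zero_add, pow_one]; exact hr
    | succ n ih => rw [pow_succ']; exact 𝒯.comp_mem_filt ih hr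
  have hnil : IsNilpotent (End.of r : End (𝒯.F.obj x)) :=
    ⟨x.level + x.level + 1, 𝒯.eq_zero_of_mem_filt (Nat.lt_succ_self _) (hpow _)⟩
  have hu : IsUnit (c • (1 : End (𝒯.F.obj x))) :=
    ⟨⟨c • 1, c⁻¹ • 1, by simp [smul_smul, hc], by simp [smul_smul, hc]⟩, rfl⟩
  have h := hnil.isUnit_add_left_of_commute hu
    ((Commute.one_right (End.of r : End (𝒯.F.obj x))).smul_right c)
  exact (isUnit_iff_isIso _).mp h

/-- A nonisomorphism between objects of the tube is a combination of paths of positive length. -/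
theorem isIso_or_mem_filt {x y : TubeVertex ρ} (f : 𝒯.F.obj x ⟶ 𝒯.F.obj y) :
    IsIso f ∨ f ∈ 𝒯.filt 1 x y := by
  by_cases hxy : x = y
  · subst hxy
    have key : ∃ (c : k), ∃ r ∈ 𝒯.filt 1 x x, f = c • 𝟙 _ + r := by
      induction 𝒯.mem_span_kap f using Submodule.span_induction with
      | zero => exact ⟨0, 0, zero_mem _, by simp⟩
      | add f g _ _ hf hg =>
        obtain ⟨c, r, hr, rfl⟩ := hf
        obtain ⟨d, s, hs, rfl⟩ := hg
        exact ⟨c + d, r + s, add_mem hr hs, by rw [add_smul]; abel⟩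
      | smul d f _ hf =>
        obtain ⟨c, r, hr, rfl⟩ := hf
        exact ⟨d * c, d • r, Submodule.smul_mem _ _ hr, by rw [smul_add, smul_smul]⟩
      | mem f hf =>
        obtain ⟨a, ha, rfl⟩ := hf
        obtain rfl | ha' := Nat.eq_zero_or_pos a
        · exact ⟨1, 0, zero_mem _, by simp⟩
        · exact ⟨0, _, Submodule.subset_span ⟨a, ha, by omega, rfl⟩, by simp⟩
    obtain ⟨c, r, hr, rfl⟩ := key
    by_cases hc : c = 0
    · right
      rwa [hc, zero_smul, zero_add]
    · exact Or.inl (𝒯.isIso_smul_add hc hr)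
  · right
    refine Submodule.span_mono ?_ (𝒯.mem_span_kap f)
    rintro _ ⟨a, ha, rfl⟩
    refine ⟨a, ha, ?_, rfl⟩
    by_contra h
    have h1 := ha.le'
    obtain rfl : a = 0 := by omega
    apply hxy
    obtain ⟨i, l⟩ := x
    obtain ⟨j, m⟩ := y
    obtain rfl : j = i := by simpa using ha.pos
    obtain rfl : l = m := by dsimp only at h h1; omega
    rfl

/-- The morphisms from `x` to `y` which are combinations of paths with at least `n` arrows on
corays. -/
def dfilt (n : ℕ) (x y : TubeVertex ρ) : Submodule k (𝒯.F.obj x ⟶ 𝒯.F.obj y) :=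
  Submodule.span k {g | ∃ a, Reach x y a ∧ n ≤ a ∧ g = 𝒯.kap x y a}

/-- Two basis morphisms with the same ends have numbers of downs that differ by a multiple of `ρ`;
the extra turns around the tube form a radical endomorphism of `y`. -/
theorem exists_comp_eq_of_mem_dfilt {x y : TubeVertex ρ} {a : ℕ} (h : Reach x y a)
    {f : 𝒯.F.obj x ⟶ 𝒯.F.obj y} (hf : f ∈ 𝒯.dfilt (a + 1) x y) :
    ∃ r ∈ 𝒯.filt 1 y y, f = 𝒯.kap x y a ≫ r := by
  induction hf using Submodule.span_induction with
  | zero => exact ⟨0, zero_mem _, comp_zero.symm⟩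
  | add f g _ _ hf hg =>
    obtain ⟨r, hr, rfl⟩ := hf
    obtain ⟨s, hs, rfl⟩ := hg
    exact ⟨r + s, add_mem hr hs, by rw [Preadditive.comp_add]⟩
  | smul c f _ hf =>
    obtain ⟨r, hr, rfl⟩ := hf
    exact ⟨c • r, Submodule.smul_mem _ _ hr, by rw [Linear.comp_smul]⟩
  | mem f hf =>
    obtain ⟨b, hb, hab, rfl⟩ := hf
    obtain ⟨d, rfl⟩ : ∃ d, b = a + d := ⟨b - a, by omega⟩
    have hd : Reach y y d := by
      refine ⟨?_, ?_, by omega⟩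
      · have h1 := h.pos.symm.trans hb.pos
        push_cast at h1
        rw [← add_assoc] at h1
        have h2 : (d : ZMod ρ) = 0 := by
          rw [← sub_eq_zero] at h1
          linear_combination -h1
        rw [h2, add_zero]
      · have := h.le'; have := hb.le; omega
    exact ⟨_, Submodule.subset_span ⟨d, hd, by omega, rfl⟩, (𝒯.kap_comp h hd).symm⟩

/-- A nonzero morphism between indecomposables of the tube is a basis morphism up to an
isomorphism. -/
theorem exists_eq_kap_comp {x y : TubeVertex ρ} {f : 𝒯.F.obj x ⟶ 𝒯.F.obj y} (hf : f ≠ 0) :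
    ∃ a, Reach x y a ∧ ∃ u : 𝒯.F.obj y ⟶ 𝒯.F.obj y, IsIso u ∧ f = 𝒯.kap x y a ≫ u := by
  have h0 : f ∈ 𝒯.dfilt 0 x y := by
    refine Submodule.span_mono ?_ (𝒯.mem_span_kap f)
    rintro _ ⟨a, ha, rfl⟩
    exact ⟨a, ha, Nat.zero_le _, rfl⟩
  have hex : ∃ a, f ∉ 𝒯.dfilt a x y := by
    refine ⟨x.level + 1, fun h => hf ?_⟩
    have hE : {g | ∃ a, Reach x y a ∧ x.level + 1 ≤ a ∧ g = 𝒯.kap x y a} = ∅ := by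
      ext g
      simp only [Set.mem_ofPred_eq, Set.mem_empty_iff_false, iff_false]
      rintro ⟨a, ha, h1, -⟩
      have := ha.le
      omega
    rwa [dfilt, hE, Submodule.span_empty, Submodule.mem_bot] at h
  classical
  -- The leading term: `a` is the least number of downs that occurs in `f`.
  obtain ⟨a, ha, ha'⟩ : ∃ a, f ∈ 𝒯.dfilt a x y ∧ f ∉ 𝒯.dfilt (a + 1) x y := by
    by_contra hcon
    push Not at hcon
    obtain ⟨a, ha⟩ := hex
    refine ha ?_
    clear ha
    induction a with
    | zero => exact h0
    | succ a ih => exact hcon a ih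
  have key : ∃ (c : k), ∃ r ∈ 𝒯.dfilt (a + 1) x y, f = c • 𝒯.kap x y a + r := by
    clear ha' h0 hf hex
    induction ha using Submodule.span_induction with
    | zero => exact ⟨0, 0, zero_mem _, by simp⟩
    | add f g _ _ hf hg =>
      obtain ⟨c, r, hr, rfl⟩ := hf
      obtain ⟨d, s, hs, rfl⟩ := hg
      exact ⟨c + d, r + s, add_mem hr hs, by rw [add_smul]; abel⟩
    | smul d f _ hf =>
      obtain ⟨c, r, hr, rfl⟩ := hf
      exact ⟨d * c, d • r, Submodule.smul_mem _ _ hr, by rw [smul_add, smul_smul]⟩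
    | mem f hf =>
      obtain ⟨b, hb, hab, rfl⟩ := hf
      obtain rfl | hab := hab.eq_or_lt
      · exact ⟨1, 0, zero_mem _, by simp⟩
      · exact ⟨0, _, Submodule.subset_span ⟨b, hb, hab, rfl⟩, by simp⟩
  obtain ⟨c, r, hr, rfl⟩ := key
  have hne : c • 𝒯.kap x y a ≠ 0 := fun h => ha' (by rwa [h, zero_add])
  have hR : Reach x y a := by
    by_contra h
    exact hne (by rw [kap_eq_zero _ h, smul_zero])
  have hc : c ≠ 0 := fun h => hne (by rw [h, zero_smul])
  obtain ⟨s, hs, rfl⟩ := 𝒯.exists_comp_eq_of_mem_dfilt hR hr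
  exact ⟨a, hR, _, 𝒯.isIso_smul_add hc hs, by
    rw [Preadditive.comp_add, Linear.comp_smul, Category.comp_id]⟩

end StandardStableTube

namespace TubeVertex

theorem reach_mk {ρ : ℕ} {i j : ZMod ρ} {l m a : ℕ} (h₁ : j = i + a) (h₂ : a ≤ l)
    (h₃ : l ≤ m + a) : Reach (⟨i, l⟩ : TubeVertex ρ) ⟨j, m⟩ a :=
  ⟨h₁, h₂, h₃⟩

end TubeVertex

namespace StandardStableTube

open TubeVertex

variable {k : Type w} [Field k] {T : Type u} [Category.{v} T] [Preadditive T] [Linear k T]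
  [HasZeroObject T] [HasShift T ℤ] [∀ n : ℤ, (shiftFunctor T n).Additive] [Pretriangulated T]
  {ρ : ℕ} (𝒯 : StandardStableTube k T ρ)

theorem map_up (i : ZMod ρ) (l : ℕ) : 𝒯.F.map (up i l) = 𝒯.kap ⟨i, l⟩ ⟨i, l + 1⟩ 0 := by
  rw [← evArrow_up]
  exact (one_smul ℤ _).symm

theorem map_down (i : ZMod ρ) (l : ℕ) :
    𝒯.F.map (down i l) = (-1 : ℤ) ^ l • 𝒯.kap ⟨i, l + 1⟩ ⟨i + 1, l⟩ 1 := by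
  rw [← evArrow_down]
  change _ = (-1 : ℤ) ^ l • (-1 : ℤ) ^ l • 𝒯.F.map (down i l)
  rw [smul_smul, ← mul_pow]
  simp

/-! ### Rectangles of the tube as weak pullbacks -/

section WeakPullback

variable {X : T}

/-- At the mouth, a morphism killed by the arrow on the coray lifts along the ray. -/
theorem exists_lift_mouth {i j : ZMod ρ} (hj : j = i + 1) (u : X ⟶ 𝒯.F.obj ⟨i, 1⟩)
    (hu : u ≫ 𝒯.kap ⟨i, 1⟩ ⟨j, 0⟩ 1 = 0) :
    ∃ w : X ⟶ 𝒯.F.obj ⟨i, 0⟩, u = w ≫ 𝒯.kap ⟨i, 0⟩ ⟨i, 1⟩ 0 := by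
  subst hj
  obtain ⟨h, H⟩ := 𝒯.ar_mouth i
  obtain ⟨w, hw⟩ := Triangle.coyoneda_exact₂ _ H.distinguished u (by
    change u ≫ 𝒯.F.map (down i 0) = 0
    rw [map_down, Preadditive.comp_zsmul, hu, smul_zero])
  exact ⟨w, hw.trans (congrArg (w ≫ ·) (𝒯.map_up i 0))⟩

/-- The mesh squares are weak pullbacks. -/
theorem exists_lift_mesh {i j : ZMod ρ} (hj : j = i + 1) {l : ℕ} (u : X ⟶ 𝒯.F.obj ⟨i, l + 2⟩)
    (h : X ⟶ 𝒯.F.obj ⟨j, l⟩)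
    (hu : u ≫ 𝒯.kap ⟨i, l + 2⟩ ⟨j, l + 1⟩ 1 = h ≫ 𝒯.kap ⟨j, l⟩ ⟨j, l + 1⟩ 0) :
    ∃ w : X ⟶ 𝒯.F.obj ⟨i, l + 1⟩, w ≫ 𝒯.kap ⟨i, l + 1⟩ ⟨i, l + 2⟩ 0 = u ∧
      w ≫ 𝒯.kap ⟨i, l + 1⟩ ⟨j, l⟩ 1 = h := by
  subst hj
  obtain ⟨d, H⟩ := 𝒯.ar_mesh i l
  obtain ⟨w, hw⟩ : ∃ w : X ⟶ 𝒯.F.obj ⟨i, l + 1⟩, biprod.lift u ((-1 : ℤ) ^ l • h) = w ≫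
      biprod.lift (𝒯.F.map (up i (l + 1))) (𝒯.F.map (down i l)) :=
    Triangle.coyoneda_exact₂ _ H.distinguished (biprod.lift u ((-1 : ℤ) ^ l • h)) (by
    change biprod.lift u ((-1 : ℤ) ^ l • h) ≫
      biprod.desc (𝒯.F.map (down i (l + 1))) (𝒯.F.map (up (i + 1) l)) = 0
    rw [biprod.lift_desc, map_down, map_up, Preadditive.comp_zsmul, Preadditive.zsmul_comp, hu,
      pow_succ, mul_neg_one, neg_smul, neg_add_cancel])
  rw [map_up, map_down] at hw
  have h1 := congrArg (· ≫ biprod.fst) hw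
  have h2 := congrArg (· ≫ biprod.snd) hw
  simp only [Category.assoc, biprod.lift_fst, biprod.lift_snd, Preadditive.comp_zsmul] at h1 h2
  refine ⟨w, h1.symm, ?_⟩
  have h3 := congrArg ((-1 : ℤ) ^ l • ·) h2
  simp only [smul_smul, ← mul_pow] at h3
  simpa using h3.symm

/-- Rectangles with a side of length one on a coray are weak pullbacks. -/
theorem exists_lift_strip {i j : ZMod ρ} (hj : j = i + 1) {l m : ℕ} (hm : l ≤ m)
    (u : X ⟶ 𝒯.F.obj ⟨i, m + 1⟩) (h : X ⟶ 𝒯.F.obj ⟨j, l⟩)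
    (hu : u ≫ 𝒯.kap ⟨i, m + 1⟩ ⟨j, m⟩ 1 = h ≫ 𝒯.kap ⟨j, l⟩ ⟨j, m⟩ 0) :
    ∃ w : X ⟶ 𝒯.F.obj ⟨i, l + 1⟩, w ≫ 𝒯.kap ⟨i, l + 1⟩ ⟨i, m + 1⟩ 0 = u ∧
      w ≫ 𝒯.kap ⟨i, l + 1⟩ ⟨j, l⟩ 1 = h := by
  obtain ⟨r, rfl⟩ := Nat.exists_eq_add_of_le hm
  clear hm
  induction r with
  | zero =>
    refine ⟨u, ?_, ?_⟩
    · exact (congrArg (u ≫ ·) (𝒯.kap_self _)).trans (Category.comp_id _)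
    · exact hu.trans ((congrArg (h ≫ ·) (𝒯.kap_self _)).trans (Category.comp_id _))
  | succ r ih =>
    have h1 : h ≫ 𝒯.kap ⟨j, l⟩ ⟨j, l + (r + 1)⟩ 0 =
        (h ≫ 𝒯.kap ⟨j, l⟩ ⟨j, l + r⟩ 0) ≫ 𝒯.kap ⟨j, l + r⟩ ⟨j, l + r + 1⟩ 0 := by
      rw [Category.assoc, kap_comp _ (reach_mk (by simp) (by omega) (by omega))
        (reach_mk (by simp) (by omega) (by omega))]
      rfl
    obtain ⟨w, hw, hw'⟩ := 𝒯.exists_lift_mesh hj (l := l + r) u _ (hu.trans h1)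
    obtain ⟨w', h2, h3⟩ := ih w hw'
    refine ⟨w', ?_, h3⟩
    rw [← hw, ← h2, Category.assoc, kap_comp _ (reach_mk (by simp) (by omega) (by omega))
        (reach_mk (by simp) (by omega) (by omega))]
    rfl

/-- A morphism killed by a path on a ray lifts along every path on a coray. -/
theorem exists_lift_of_comp_up_eq_zero (s : ℕ) : ∀ {i j : ZMod ρ} (_ : j = i + s) {l m r : ℕ}
    (_ : m = l + s) (_ : l ≤ r) (h : X ⟶ 𝒯.F.obj ⟨j, l⟩) (_ : h ≫ 𝒯.kap ⟨j, l⟩ ⟨j, r⟩ 0 = 0),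
    ∃ w : X ⟶ 𝒯.F.obj ⟨i, m⟩, w ≫ 𝒯.kap ⟨i, m⟩ ⟨j, l⟩ s = h := by
  induction s with
  | zero =>
    intro i j hj l m r hm hr h hh
    obtain rfl : j = i := by simpa using hj
    obtain rfl : m = l := hm
    exact ⟨h, by rw [kap_self, Category.comp_id]⟩
  | succ s ih =>
    intro i j hj l m r hm hr h hh
    have hj' : j = i + s + 1 := by rw [hj]; push_cast; ring
    -- Pairing `h` with the zero map gives a lift that is again killed along its ray, so the
    -- induction continues.
    obtain ⟨w, hw, hw'⟩ := 𝒯.exists_lift_strip hj' hr (0 : X ⟶ 𝒯.F.obj ⟨i + s, r + 1⟩) h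
      (by rw [hh, zero_comp])
    obtain ⟨w', hw''⟩ := ih rfl (m := m) (by omega) (Nat.succ_le_succ hr) w hw
    refine ⟨w', ?_⟩
    rw [← hw', ← hw'', Category.assoc, kap_comp _ (reach_mk rfl (by omega) (by omega))
      (reach_mk (by rw [hj', Nat.cast_one]) (by omega) (by omega))]

/-- A morphism killed by a path on a coray lifts along a path on a ray. -/
theorem exists_lift_of_comp_down_eq_zero (s : ℕ) : ∀ {i j : ZMod ρ} (_ : j = i + (s + 1 : ℕ))
    {l m : ℕ} (_ : m = l + s + 1) (u : X ⟶ 𝒯.F.obj ⟨i, m⟩)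
    (_ : u ≫ 𝒯.kap ⟨i, m⟩ ⟨j, l⟩ (s + 1) = 0),
    ∃ w : X ⟶ 𝒯.F.obj ⟨i, s⟩, u = w ≫ 𝒯.kap ⟨i, s⟩ ⟨i, m⟩ 0 := by
  induction s with
  | zero =>
    intro i j hj l m hm u hu
    obtain rfl : m = l + 1 := hm
    have hj' : j = i + 1 := by simpa using hj
    induction l with
    | zero => exact 𝒯.exists_lift_mouth hj' u hu
    | succ l ih =>
      obtain ⟨w, hw, hw'⟩ := 𝒯.exists_lift_mesh hj' u 0 (by rw [zero_comp]; exact hu)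
      obtain ⟨w', rfl⟩ := ih w hw'
      refine ⟨w', ?_⟩
      rw [← hw, Category.assoc, kap_comp _ (reach_mk (by simp) (by omega) (by omega))
        (reach_mk (by simp) (by omega) (by omega))]
  | succ s ih =>
    intro i j hj l m hm u hu
    obtain rfl : m = l + s + 1 + 1 := by omega
    have hj' : j = i + 1 + (s + 1 : ℕ) := by rw [hj]; push_cast; ring
    -- Move `u` one step down the coray, factor it along the ray there, and pull the factor back
    -- through the strip.
    obtain ⟨v, hv⟩ := ih hj' (l := l) rfl (u ≫ 𝒯.kap _ ⟨i + 1, l + s + 1⟩ 1) (by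
      rw [Category.assoc, kap_comp _ (reach_mk (by simp) (by omega) (by omega))
        (reach_mk hj' (by omega) (by omega)), add_comm 1 (s + 1), hu])
    obtain ⟨w, hw, -⟩ := 𝒯.exists_lift_strip rfl (by omega) u v hv
    exact ⟨w, hw.symm⟩

end WeakPullback

/-! ### Factoring through objects outside the tube -/

section AlmostSplit

variable {Z : T}

/-- A morphism to the tube from an object without summands in the tube lifts along the corays. -/
theorem exists_lift_down (hZ : ∀ x : TubeVertex ρ, IsEmpty (Retract (𝒯.F.obj x) Z)) {i j : ZMod ρ}
    (hj : j = i + 1) {l : ℕ} (g : Z ⟶ 𝒯.F.obj ⟨j, l⟩) :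
    ∃ g' : Z ⟶ 𝒯.F.obj ⟨i, l + 1⟩, g = g' ≫ 𝒯.kap ⟨i, l + 1⟩ ⟨j, l⟩ 1 := by
  subst hj
  have hg {x} (g : Z ⟶ 𝒯.F.obj x) : ¬ IsSplitEpi g := fun h =>
    (hZ x).false ⟨section_ g, g, IsSplitEpi.id g⟩
  induction l with
  | zero =>
    obtain ⟨d, H⟩ := 𝒯.ar_mouth i
    obtain ⟨g', h⟩ := H.almost_split Z g (hg g)
    change g' ≫ 𝒯.F.map (down i 0) = g at h
    rw [map_down, pow_zero, one_smul] at h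
    exact ⟨g', h.symm⟩
  | succ l ih =>
    obtain ⟨d, H⟩ := 𝒯.ar_mesh i l
    obtain ⟨e, h⟩ : ∃ e : Z ⟶ 𝒯.F.obj ⟨i, l + 2⟩ ⊞ 𝒯.F.obj ⟨i + 1, l⟩,
        e ≫ biprod.desc (𝒯.F.map (down i (l + 1))) (𝒯.F.map (up (i + 1) l)) = g :=
      H.almost_split Z g (hg g)
    rw [biprod.desc_eq, Preadditive.comp_add, map_down, map_up] at h
    -- The component of the lift at `⟨i + 1, l⟩` has smaller level; its own lift is rerouted through
    -- the commuting mesh.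
    obtain ⟨b, hb⟩ := ih (e ≫ biprod.snd)
    refine ⟨(-1 : ℤ) ^ (l + 1) • (e ≫ biprod.fst) + b ≫ 𝒯.kap ⟨i, l + 1⟩ ⟨i, l + 1 + 1⟩ 0, ?_⟩
    have h1 : 𝒯.kap ⟨i, l + 1⟩ ⟨i, l + 1 + 1⟩ 0 ≫ 𝒯.kap ⟨i, l + 1 + 1⟩ ⟨i + 1, l + 1⟩ 1 =
        𝒯.kap ⟨i, l + 1⟩ ⟨i + 1, l⟩ 1 ≫ 𝒯.kap ⟨i + 1, l⟩ ⟨i + 1, l + 1⟩ 0 := by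
      rw [kap_comp _ (reach_mk (by simp) (by omega) (by omega))
        (reach_mk (by simp) (by omega) (by omega)),
        kap_comp _ (reach_mk (by simp) (by omega) (by omega))
        (reach_mk (by simp) (by omega) (by omega))]
    rw [Preadditive.add_comp, Category.assoc, h1, ← Category.assoc b, ← hb, ← h]
    simp only [Preadditive.comp_zsmul, Preadditive.zsmul_comp, Category.assoc]

theorem exists_lift_down_pow (hZ : ∀ x : TubeVertex ρ, IsEmpty (Retract (𝒯.F.obj x) Z))
    {y : TubeVertex ρ} (g : Z ⟶ 𝒯.F.obj y) (n : ℕ) :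
    ∃ (x : TubeVertex ρ) (_ : Reach x y n) (g' : Z ⟶ 𝒯.F.obj x), g = g' ≫ 𝒯.kap x y n := by
  induction n with
  | zero => exact ⟨y, reach_self y, g, by simp⟩
  | succ n ih =>
    obtain ⟨⟨j, l⟩, hx, g', rfl⟩ := ih
    have hj : j = j - 1 + 1 := by ring
    obtain ⟨g'', rfl⟩ := 𝒯.exists_lift_down hZ hj g'
    have h1 : Reach (⟨j - 1, l + 1⟩ : TubeVertex ρ) ⟨j, l⟩ 1 := reach_mk (by simp) (by omega) le_rfl
    have h2 : Reach ⟨j - 1, l + 1⟩ y (1 + n) :=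
      h1.trans hx (by have := hx.le; dsimp only at this ⊢; omega)
    rw [Category.assoc, kap_comp _ h1 hx, add_comm]
    exact ⟨_, add_comm 1 n ▸ h2, g'', rfl⟩

/-- Morphisms in the tube which factor through an object without summands in the tube vanish. -/
theorem comp_eq_zero (hZ : ∀ x : TubeVertex ρ, IsEmpty (Retract (𝒯.F.obj x) Z))
    {x y : TubeVertex ρ} (f : 𝒯.F.obj x ⟶ Z) (g : Z ⟶ 𝒯.F.obj y) : f ≫ g = 0 := by
  -- No basis morphism out of `x` survives `x.level + 1` downs.
  obtain ⟨z, hz, g', rfl⟩ := 𝒯.exists_lift_down_pow hZ g (x.level + 1)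
  rw [← Category.assoc]
  have hf := 𝒯.mem_span_kap (f ≫ g')
  generalize f ≫ g' = h at hf
  induction hf using Submodule.span_induction with
  | zero => exact zero_comp
  | add a b _ _ ha hb => rw [Preadditive.add_comp, ha, hb, add_zero]
  | smul c a _ ha => rw [Linear.smul_comp, ha, smul_zero]
  | mem a ha =>
    obtain ⟨a, ha, rfl⟩ := ha
    rw [kap_comp _ ha hz, kap_eq_zero]
    intro h
    have := h.le
    omega

end AlmostSplit

end StandardStableTube

/-! ### Direct summands and co-aisles in pretriangulated categories -/

section Pretriangulated

variable {T : Type u} [Category.{v} T] [Preadditive T]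
  [HasZeroObject T] [HasShift T ℤ] [∀ n : ℤ, (shiftFunctor T n).Additive] [Pretriangulated T]

/-- A split epimorphism in a pretriangulated category is the projection to a direct summand. -/
theorem exists_iso_biprod_of_section {Y S : T} (s : Y ⟶ S) (r : S ⟶ Y) (h : r ≫ s = 𝟙 S) :
    ∃ (S' : T) (e : Y ≅ S ⊞ S'), e.hom ≫ biprod.fst = s := by
  obtain ⟨S', f, d, H⟩ := distinguished_cocone_triangle₁ s
  have hd : d = 0 := by
    have h1 : s ≫ d = 0 := comp_distTriang_mor_zero₂₃ _ H
    rw [← Category.id_comp d, ← h, Category.assoc, h1, comp_zero]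
  obtain ⟨e, he⟩ : ∃ e : Y ≅ S' ⊞ S, s = e.hom ≫ biprod.snd :=
    (exists_iso_binaryBiproduct_of_distTriang _ H hd).imp fun _ h => h.2
  refine ⟨S', e ≪≫ biprod.braiding S' S, ?_⟩
  rw [Iso.trans_hom, Category.assoc, biprod.braiding_hom, biprod.lift_fst]
  exact he.symm

theorem nonempty_iso_of_indecomposable_of_retract {X Y : T} (hX : Indecomposable X)
    (h : Retract Y X) (hY : ¬ IsZero Y) : Nonempty (X ≅ Y) := by
  obtain ⟨S, e, -⟩ := exists_iso_biprod_of_section h.r h.i h.retract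
  have hS : IsZero S := (hX.2 _ _ e).resolve_left hY
  exact ⟨e ≪≫ (isoBiprodZero hS).symm⟩

namespace CategoryTheory.Triangulated.TStructure

variable (τ : TStructure T)

/-- If the truncation map `X ⟶ Y` is zero, then `X⟦1⟧` is a retract of `Z`; but there are no nonzero
maps from `X⟦1⟧` to `Z`, so `X` vanishes. -/
theorem ge_one_of_orthogonal {Y : T} (h : ∀ (X : T) (f : X ⟶ Y), τ.le 0 X → f = 0) :
    τ.ge 1 Y := by
  obtain ⟨X, Z, hX, hZ, f, g, d, H⟩ := τ.exists_triangle_zero_one Y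
  have : Epi d := Triangle.epi₃ _ H (h X f hX)
  have hd : IsSplitEpi d := isSplitEpi_of_epi d
  have hX1 : τ.le 0 (X⟦(1 : ℤ)⟧) :=
    τ.le_monotone (by norm_num : (-1 : ℤ) ≤ 0) _ (τ.le_shift 0 1 (-1) (by norm_num) X hX)
  have h0 : 𝟙 (X⟦(1 : ℤ)⟧) = 0 := by
    rw [← IsSplitEpi.id d, τ.zero' (section_ d) hX1 hZ, zero_comp]
  have hX0 : IsZero X := by
    rw [IsZero.iff_id_eq_zero]
    apply (shiftFunctor T (1 : ℤ)).map_injective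
    rw [Functor.map_id, h0, Functor.map_zero]
  have hg : IsIso g := (Triangle.isZero₁_iff_isIso₂ _ H).mp hX0
  exact (τ.ge 1).prop_of_iso (asIso g).symm hZ

theorem ge_one_of_retract {Y Z : T} (h : Retract Y Z) (hZ : τ.ge 1 Z) : τ.ge 1 Y := by
  refine τ.ge_one_of_orthogonal fun X f hX => ?_
  rw [← Category.comp_id f, ← h.retract, ← Category.assoc, τ.zero' (f ≫ h.i) hX hZ, zero_comp]

/-- The co-aisle is closed under cocones. -/
theorem ge_one_of_distTriang {K Y Z : T} {f : K ⟶ Y} {g : Y ⟶ Z} {d : Z ⟶ K⟦(1 : ℤ)⟧}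
    (H : Triangle.mk f g d ∈ distTriang T) (hY : τ.ge 1 Y) (hZ : τ.ge 1 Z) : τ.ge 1 K := by
  refine τ.ge_one_of_orthogonal fun X a hX => ?_
  obtain ⟨b, hb⟩ : ∃ b : X ⟶ Z⟦(-1 : ℤ)⟧, a = b ≫ (Triangle.mk f g d).invRotate.mor₁ :=
    Triangle.coyoneda_exact₂ _ (inv_rot_of_distTriang _ H) a (τ.zero' (a ≫ f) hX hY)
  have h2 : τ.ge 2 (Z⟦(-1 : ℤ)⟧) := τ.ge_shift 1 (-1) 2 (by norm_num) Z hZ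
  have hb0 : b = 0 := τ.zero' b hX (τ.ge_antitone (by norm_num : (1 : ℤ) ≤ 2) _ h2)
  rw [hb, hb0]
  exact zero_comp

end CategoryTheory.Triangulated.TStructure

end Pretriangulated

namespace StandardStableTube

open TubeVertex

variable {k : Type w} [Field k] {T : Type u} [Category.{v} T] [Preadditive T] [Linear k T]
  [HasZeroObject T] [HasShift T ℤ] [∀ n : ℤ, (shiftFunctor T n).Additive] [Pretriangulated T]
  {ρ : ℕ} (𝒯 : StandardStableTube k T ρ)

/-! ### Periodicity of co-aisles along rays -/

section Coaisle

variable (τ : TStructure T)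

/-- The long object both receives `⟨j, m⟩` along the ray and, as positions are modulo `ρ`, maps to
it along the coray. A map from the aisle dies on the way up, hence lifts along the coray to the long
object, where it is zero. -/
theorem ge_one_of_add_rank {j : ZMod ρ} {m : ℕ} (h : τ.ge 1 (𝒯.F.obj ⟨j, m + ρ⟩)) :
    τ.ge 1 (𝒯.F.obj ⟨j, m⟩) := by
  refine τ.ge_one_of_orthogonal fun X f hX => ?_
  obtain ⟨w, rfl⟩ := 𝒯.exists_lift_of_comp_up_eq_zero ρ (i := j) (m := m + ρ) (by simp) rfl
    (Nat.le_add_right m ρ) f (τ.zero' _ hX h)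
  rw [τ.zero' w hX h, zero_comp]

theorem isIso_of_comp_eq {x y : TubeVertex ρ} {f : 𝒯.F.obj x ⟶ 𝒯.F.obj x}
    {g : 𝒯.F.obj x ⟶ 𝒯.F.obj y} (hg : g ≠ 0) (h : f ≫ g = g) : IsIso f := by
  refine (𝒯.isIso_or_mem_filt f).resolve_right fun hf => hg ?_
  have hu := 𝒯.isIso_smul_add one_ne_zero (neg_mem hf)
  rw [one_smul] at hu
  rw [← cancel_epi (𝟙 _ + -f), Preadditive.add_comp, Preadditive.neg_comp, h, Category.id_comp,
    add_neg_cancel, comp_zero]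

/-- The object of length `ρ` acts as a kernel of the coray map `⟨j, m + ρ⟩ ⟶ ⟨j, m⟩`: it is a
retract of the cocone, which lies in the co-aisle. -/
theorem ge_one_rank_of_add_rank (hρ : 0 < ρ) {j : ZMod ρ} {m : ℕ}
    (h : τ.ge 1 (𝒯.F.obj ⟨j, m + ρ⟩)) : τ.ge 1 (𝒯.F.obj ⟨j, ρ - 1⟩) := by
  have hR : Reach (⟨j, m + ρ⟩ : TubeVertex ρ) ⟨j, m⟩ ρ := reach_mk (by simp) (by omega) le_rfl
  have hR' : Reach (⟨j, ρ - 1⟩ : TubeVertex ρ) ⟨j, m + ρ⟩ 0 :=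
    reach_mk (by simp) (by omega) (by omega)
  obtain ⟨K, c, d, H⟩ := distinguished_cocone_triangle₁ (𝒯.kap ⟨j, m + ρ⟩ ⟨j, m⟩ ρ)
  have hK : τ.ge 1 K := τ.ge_one_of_distTriang H h (𝒯.ge_one_of_add_rank τ h)
  obtain ⟨a, ha⟩ : ∃ a : 𝒯.F.obj ⟨j, ρ - 1⟩ ⟶ K, 𝒯.kap ⟨j, ρ - 1⟩ ⟨j, m + ρ⟩ 0 = a ≫ c :=
    Triangle.coyoneda_exact₂ _ H _ ((𝒯.kap_comp hR' hR).trans (𝒯.kap_eq_zero fun hc => by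
      have := hc.le
      dsimp only at this
      omega))
  obtain ⟨b, hb⟩ := 𝒯.exists_lift_of_comp_down_eq_zero (ρ - 1) (i := j) (j := j) (l := m)
    (by rw [Nat.sub_add_cancel hρ]; simp) (by omega) c
    (by rw [Nat.sub_add_cancel hρ]; exact comp_distTriang_mor_zero₁₂ _ H)
  have hab : IsIso (a ≫ b) := 𝒯.isIso_of_comp_eq (𝒯.kap_ne_zero hR') (by
    rw [Category.assoc, ← hb, ← ha])
  exact τ.ge_one_of_retract ⟨a, b ≫ inv (a ≫ b), by rw [← Category.assoc, IsIso.hom_inv_id]⟩ hK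

/-- If the co-aisle of a t-structure contains a long indecomposable of the tube, then it contains
the indecomposables on the same ray whose length is a multiple of the rank. -/
theorem ge_one_mul_rank (hρ : 0 < ρ) {j : ZMod ρ} {m : ℕ} (hm : ρ ≤ m)
    (h : τ.ge 1 (𝒯.F.obj ⟨j, m⟩)) (s : ℕ) : τ.ge 1 (𝒯.F.obj ⟨j, s * ρ + (ρ - 1)⟩) := by
  obtain ⟨m, rfl⟩ := Nat.exists_eq_add_of_le' hm
  have h1 := 𝒯.ge_one_rank_of_add_rank τ hρ h
  induction s with
  | zero => simpa using h1
  | succ s ih =>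
    have hs : (s + 1) * ρ + (ρ - 1) = s * ρ + (ρ - 1) + (ρ - 1) + 1 := by
      rw [Nat.succ_mul]; omega
    rw [hs]
    -- Going `ρ` steps down the coray leads to the previous object of the induction, so a map from
    -- the aisle dies there and factors through the object of length `ρ`.
    refine τ.ge_one_of_orthogonal fun X f hX => ?_
    obtain ⟨w, rfl⟩ := 𝒯.exists_lift_of_comp_down_eq_zero (ρ - 1) (i := j) (j := j)
      (by rw [Nat.sub_add_cancel hρ]; simp) rfl f (τ.zero' _ hX ih)
    rw [τ.zero' w hX h1, zero_comp]

end Coaisle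

/-! ### Left minimality -/

section Minimal

/-- A morphism between finite direct sums of indecomposables of the tube all of whose components
are nonisomorphisms is nilpotent. -/
theorem isNilpotent_of_components {n : ℕ} (x : Fin n → TubeVertex ρ)
    (h : (⨁ fun j => 𝒯.F.obj (x j)) ⟶ ⨁ fun j => 𝒯.F.obj (x j))
    (hh : ∀ i j, biproduct.ι (fun j => 𝒯.F.obj (x j)) i ≫ h ≫ biproduct.π _ j ∈
      𝒯.filt 1 (x i) (x j)) : IsNilpotent (End.of h) := by
  have key (N : ℕ) : ∀ i j, biproduct.ι (fun j => 𝒯.F.obj (x j)) i ≫ (End.of h ^ (N + 1)).asHom ≫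
      biproduct.π _ j ∈ 𝒯.filt (N + 1) (x i) (x j) := by
    induction N with
    | zero => simpa using hh
    | succ N ih =>
      intro i j
      have h1 : (End.of h ^ (N + 1 + 1)).asHom = (End.of h ^ (N + 1)).asHom ≫ h := by
        rw [pow_succ']; rfl
      have h2 : biproduct.ι (fun j => 𝒯.F.obj (x j)) i ≫ (End.of h ^ (N + 1 + 1)).asHom ≫
          biproduct.π _ j = ∑ m, (biproduct.ι (fun j => 𝒯.F.obj (x j)) i ≫
            (End.of h ^ (N + 1)).asHom ≫ biproduct.π _ m) ≫ biproduct.ι (fun j => 𝒯.F.obj (x j)) m ≫ h ≫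
            biproduct.π _ j := by
        rw [h1]
        generalize (End.of h ^ (N + 1)).asHom = A
        conv_lhs => rw [← Category.id_comp h, ← biproduct.total]
        simp only [Preadditive.sum_comp, Preadditive.comp_sum, Category.assoc]
      rw [h2]
      exact sum_mem fun m _ => 𝒯.comp_mem_filt (ih i m) (hh m j)
  let B := ∑ j, (x j).level
  refine ⟨B + B + 1, ?_⟩
  change (End.of h ^ (B + B + 1)).asHom = 0
  apply biproduct.hom_ext'
  intro i
  apply biproduct.hom_ext
  intro j
  rw [comp_zero, zero_comp, Category.assoc]
  have hB (j : Fin n) : (x j).level ≤ B :=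
    Finset.single_le_sum (f := fun j => (x j).level) (fun _ _ => Nat.zero_le _)
      (Finset.mem_univ j)
  exact 𝒯.eq_zero_of_mem_filt (by have := hB i; have := hB j; omega) (key (B + B) i j)

/-- A morphism to an object of the tube which is nonzero on all summands is left minimal. -/
theorem isIso_of_isNonzeroOnSummands {t Y : T} (hY : 𝒯.mem Y) {α : t ⟶ Y}
    (hα : IsNonzeroOnSummands α) {e : Y ⟶ Y} (he : α ≫ e = α) : IsIso e := by
  obtain ⟨n, x, ⟨c⟩⟩ := hY
  let h := c.inv ≫ (𝟙 Y - e) ≫ c.hom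
  have hh : IsNilpotent (End.of h) := by
    refine 𝒯.isNilpotent_of_components x h fun i j => ?_
    refine (𝒯.isIso_or_mem_filt _).resolve_left fun hi => ?_
    -- An invertible component of `𝟙 Y - e` would make this map the projection to a nonzero summand,
    -- yet `α` composed with it is zero.
    obtain ⟨S', e', he'⟩ := exists_iso_biprod_of_section ((𝟙 Y - e) ≫ c.hom ≫ biproduct.π _ j)
      (inv (biproduct.ι (fun j => 𝒯.F.obj (x j)) i ≫ h ≫ biproduct.π _ j) ≫
        biproduct.ι (fun j => 𝒯.F.obj (x j)) i ≫ c.inv) (by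
        rw [← IsIso.inv_hom_id (biproduct.ι (fun j => 𝒯.F.obj (x j)) i ≫ h ≫ biproduct.π _ j)]
        simp only [h, Category.assoc])
    refine hα _ S' e' (𝒯.not_isZero_obj _) ?_
    rw [he', ← Category.assoc, Preadditive.comp_sub, he, Category.comp_id, sub_self, zero_comp]
  have hu : IsIso (𝟙 _ - h) := (isUnit_iff_isIso _).mp hh.isUnit_one_sub
  have : e = c.hom ≫ (𝟙 _ - h) ≫ c.inv := by
    simp [h]
  rw [this]
  infer_instance

end Minimal

end StandardStableTube

/-! ### Stabilisation of upper sets -/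

/-- A descending chain of upper sets in a strip of finite width stabilises, if each of them is
generated by elements of a subset `P n` with which the preceding one has the same intersection, and
if every row of `P n` which is nonempty above `b₀` contains an unbounded set independent of `n`. -/
theorem exists_stable_upper_sets (l b₀ : ℕ) (U P : ℕ → ℕ → ℕ → Prop) (D : ℕ → ℕ → Prop)
    (hl : ∀ {n a b}, U n a b → a ≤ l)
    (hup : ∀ {n a b a' b'}, U n a b → a ≤ a' → b ≤ b' → a' ≤ l → U n a' b')
    (hanti : ∀ {n a b}, U (n + 1) a b → U n a b)
    (hgen : ∀ {n a b}, U (n + 1) a b → ∃ a' ≤ a, ∃ b' ≤ b, U (n + 1) a' b' ∧ P (n + 1) a' b')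
    (hinter : ∀ {n a b}, U n a b → P (n + 1) a b → U (n + 1) a b)
    (hper : ∀ {n a b b'}, a ≤ l → P n a b → b₀ ≤ b → D a b' → P n a b')
    (hD : ∀ {a}, a ≤ l → ∀ c, ∃ b, c ≤ b ∧ D a b) :
    ∃ N, ∀ n ≥ N, ∀ a b, U n a b → U (n + 1) a b := by
  classical
  have hanti' : ∀ {m n a b}, m ≤ n → U n a b → U m a b := by
    intro m n a b hmn
    induction n, hmn using Nat.le_induction with
    | base => exact id
    | succ n _ ih => exact fun h => ih (hanti h)
  by_cases hne : ∀ n, ∃ a b, U n a b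
  swap
  · push Not at hne
    obtain ⟨N, hN⟩ := hne
    exact ⟨N, fun n hn a b h => absurd (hanti' hn h) (hN a b)⟩
  -- Row `a` is the lowest one that remains occupied forever. Generators below an element of it must
  -- lie in the same row.
  obtain ⟨N, a, hrow, hmin⟩ : ∃ N a, (∀ n ≥ N, ∃ b, U n a b) ∧
      ∀ n ≥ N, ∀ a' b, U n a' b → a ≤ a' := by
    let q (c : ℕ) : Prop := ∀ n, ∃ a b, U n a b ∧ a ≤ c
    have hq : ∃ c, q c := ⟨l, fun n => by
      obtain ⟨a, b, h⟩ := hne n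
      exact ⟨a, b, h, hl h⟩⟩
    have hspec := Nat.find_spec hq
    have hex : ∃ N, ∀ a b, U N a b → Nat.find hq ≤ a := by
      rcases Nat.eq_zero_or_pos (Nat.find hq) with h0 | hpos
      · exact ⟨0, fun a b _ => h0 ▸ Nat.zero_le a⟩
      · have h1 := Nat.find_min hq (Nat.sub_lt hpos one_pos)
        simp only [q] at h1
        push Not at h1
        obtain ⟨N, hN⟩ := h1
        exact ⟨N, fun a b h => by have := hN a b h; omega⟩
    obtain ⟨N, hN⟩ := hex
    refine ⟨N, Nat.find hq, fun n hn => ?_, fun n hn a' b h => hN a' b (hanti' hn h)⟩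
    obtain ⟨a, b, h, hle⟩ := hspec n
    exact ⟨b, le_antisymm hle (hN a b (hanti' hn h)) ▸ h⟩
  have ha : a ≤ l := by
    obtain ⟨b, h⟩ := hrow N le_rfl
    exact hl h
  have hrowP : ∀ n ≥ N, ∃ b, U (n + 1) a b ∧ P (n + 1) a b := by
    intro n hn
    obtain ⟨b, h⟩ := hrow (n + 1) (by omega)
    obtain ⟨a', ha', b', -, h', hP⟩ := hgen h
    obtain rfl : a = a' := le_antisymm (hmin (n + 1) (by omega) _ _ h') ha'
    exact ⟨b', h', hP⟩
  -- Either row `a` always meets the part up to `b₀`, or from some stage on its generators lie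
  -- beyond `b₀`. In the second case each `P (n + 1)` contains a fixed `B` from `D`, and `hinter`
  -- preserves it.
  obtain ⟨B, N', hN', hB⟩ : ∃ B N', N ≤ N' ∧ ∀ n ≥ N', U n a B := by
    by_cases hcase : ∀ n ≥ N, ∃ b ≤ b₀, U n a b
    · refine ⟨b₀, N, le_rfl, fun n hn => ?_⟩
      obtain ⟨b, hb, h⟩ := hcase n hn
      exact hup h le_rfl hb ha
    · push Not at hcase
      obtain ⟨N', hN', hcase⟩ := hcase
      obtain ⟨b, hb⟩ := hrow N' hN'
      obtain ⟨B, hbB, hDB⟩ := hD ha b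
      refine ⟨B, N', hN', fun n hn => ?_⟩
      induction n, hn using Nat.le_induction with
      | base => exact hup hb le_rfl hbB ha
      | succ n hn ih =>
        obtain ⟨b', h', hP⟩ := hrowP n (hN'.trans hn)
        refine hinter ih (hper ha hP ?_ hDB)
        by_contra hlt
        exact hcase b' (by omega) (hanti' (Nat.le_succ_of_le hn) h')
  -- Beyond column `B` membership follows from `(a, B)`, so only a finite box is left to stabilise.
  let s (n : ℕ) : Finset (ℕ × ℕ) :=
    (Finset.range (l + 1) ×ˢ Finset.range (B + 1)).filter fun p => U n p.1 p.2
  have hs : ∀ {m n}, m ≤ n → s n ⊆ s m := fun hmn p hp => by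
    rw [Finset.mem_filter] at hp ⊢
    exact ⟨hp.1, hanti' hmn hp.2⟩
  obtain ⟨N'', hN'', hcard⟩ : ∃ N'', N' ≤ N'' ∧ ∀ n ≥ N', (s N'').card ≤ (s n).card := by
    have hex : ∃ c, ∃ n ≥ N', (s n).card = c := ⟨_, N', le_rfl, rfl⟩
    obtain ⟨n, hn, h⟩ := Nat.find_spec hex
    exact ⟨n, hn, fun m hm => h ▸ Nat.find_min' hex ⟨m, hm, rfl⟩⟩
  refine ⟨N'', fun n hn a' b h => ?_⟩
  have haa' := hmin n (by omega) a' b h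
  by_cases hb : b ≤ B
  · have h1 : s (n + 1) = s n := by
      refine Finset.eq_of_subset_of_card_le (hs (Nat.le_succ n)) ?_
      exact (Finset.card_le_card (hs hn)).trans (hcard _ (by omega))
    have h2 : (a', b) ∈ s n := by
      simp only [s, Finset.mem_filter, Finset.mem_product, Finset.mem_range]
      exact ⟨⟨Nat.lt_succ_of_le (hl h), Nat.lt_succ_of_le hb⟩, h⟩
    rw [← h1] at h2
    exact (Finset.mem_filter.mp h2).2
  · exact hup (hB (n + 1) (by omega)) haa' (by omega) (hl h)

/-! ### Existence and factorisation properties of refined truncations -/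

section Decomposition

variable {T : Type u} [Category.{v} T] [Preadditive T]
  [HasZeroObject T] [HasShift T ℤ] [∀ n : ℤ, (shiftFunctor T n).Additive] [Pretriangulated T]

/-- Given an additive size, the target of a morphism decomposes into a summand to which the
morphism is zero and one to all whose summands it is nonzero. -/
theorem exists_iso_biprod_isNonzeroOnSummands (size : T → ℕ)
    (hadd : ∀ X Y Z : T, (X ≅ Y ⊞ Z) → size X = size Y + size Z)
    (hzero : ∀ X, size X = 0 → IsZero X) {t B : T} (α : t ⟶ B) :
    ∃ (Y W : T) (e : B ≅ Y ⊞ W), α ≫ e.hom ≫ biprod.snd = 0 ∧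
      IsNonzeroOnSummands (α ≫ e.hom ≫ biprod.fst) := by
  have key : ∀ (n : ℕ) (Y W : T) (e : B ≅ Y ⊞ W), size Y = n → α ≫ e.hom ≫ biprod.snd = 0 →
      ∃ (Y W : T) (e : B ≅ Y ⊞ W), α ≫ e.hom ≫ biprod.snd = 0 ∧
        IsNonzeroOnSummands (α ≫ e.hom ≫ biprod.fst) := by
    intro n
    induction n using Nat.strong_induction_on with
    | _ n ih =>
      intro Y W e hn he
      by_cases hα : IsNonzeroOnSummands (α ≫ e.hom ≫ biprod.fst)
      · exact ⟨Y, W, e, he, hα⟩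
      · unfold IsNonzeroOnSummands at hα
        push Not at hα
        obtain ⟨S, S', c, hS, h0⟩ := hα
        have hS' : size S ≠ 0 := fun h => hS (hzero S h)
        have hsize := hadd _ _ _ c
        -- Moving the offending summand `S` to the complement strictly lowers the size.
        let e' : B ≅ S' ⊞ (S ⊞ W) :=
          { hom := biprod.lift (e.hom ≫ biprod.fst ≫ c.hom ≫ biprod.snd)
              (biprod.lift (e.hom ≫ biprod.fst ≫ c.hom ≫ biprod.fst) (e.hom ≫ biprod.snd))
            inv := biprod.desc (biprod.inr ≫ c.inv ≫ biprod.inl ≫ e.inv)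
              (biprod.desc (biprod.inl ≫ c.inv ≫ biprod.inl ≫ e.inv) (biprod.inr ≫ e.inv))
            hom_inv_id := by
              have h1 : biprod.fst ≫ biprod.inl + biprod.snd ≫ biprod.inr = 𝟙 (S ⊞ S') :=
                biprod.total
              have h2 : biprod.fst ≫ biprod.inl + biprod.snd ≫ biprod.inr = 𝟙 (Y ⊞ W) :=
                biprod.total
              rw [biprod.lift_desc, biprod.lift_desc]
              calc _ = e.hom ≫ (biprod.fst ≫ (c.hom ≫ (biprod.fst ≫ biprod.inl +
                    biprod.snd ≫ biprod.inr) ≫ c.inv) ≫ biprod.inl + biprod.snd ≫ biprod.inr) ≫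
                    e.inv := by
                      simp only [Preadditive.comp_add, Preadditive.add_comp, Category.assoc]
                      abel
                _ = 𝟙 B := by
                      rw [h1, Category.id_comp, Iso.hom_inv_id, Category.id_comp, h2,
                        Category.id_comp, Iso.hom_inv_id]
            inv_hom_id := by
              ext <;> simp }
        refine ih (size S') (by omega) S' (S ⊞ W) e' rfl ?_
        apply biprod.hom_ext
        · simpa [e'] using h0
        · simpa [e'] using he
  obtain ⟨O, hO⟩ := HasZeroObject.zero (C := T)
  exact key _ B O (isoBiprodZero hO) rfl (hO.eq_of_tgt _ _)

theorem exists_isLeftTruncation (τ : TStructure T) (A : T) :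
    ∃ (B : T) (f : A ⟶ B), IsLeftTruncation τ f := by
  obtain ⟨X, B, hX, hB, g, f, h, H⟩ := τ.exists_triangle_zero_one A
  exact ⟨B, f, hB, X, g, h, hX, H⟩

theorem IsLeftTruncation.exists_factor {τ : TStructure T} {A B V : T} {f : A ⟶ B}
    (hf : IsLeftTruncation τ f) (hV : τ.ge 1 V) (g : A ⟶ V) : ∃ g' : B ⟶ V, g = f ≫ g' := by
  obtain ⟨-, X, i, h, hX, H⟩ := hf
  exact Triangle.yoneda_exact₂ _ H g (τ.zero' (i ≫ g) hX hV)

theorem RefinedTruncation.nonempty (size : T → ℕ)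
    (hadd : ∀ X Y Z : T, (X ≅ Y ⊞ Z) → size X = size Y + size Z)
    (hzero : ∀ X, size X = 0 → IsZero X) {d : ℕ} [NeZero d] (τ : Fin d → TStructure T) (t : T) :
    Nonempty (RefinedTruncation τ t) := by
  have hstep : ∀ (n : ℕ) (p : Σ Y : T, t ⟶ Y), ∃ (q : Σ Y : T, t ⟶ Y) (β : p.1 ⟶ q.1),
      ∃ (B W : T) (f : p.1 ⟶ B) (e : B ≅ q.1 ⊞ W),
        IsLeftTruncation (τ (Fin.ofNat d (n + 1))) f ∧ β = f ≫ e.hom ≫ biprod.fst ∧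
        p.2 ≫ f ≫ e.hom ≫ biprod.fst = q.2 ∧ p.2 ≫ f ≫ e.hom ≫ biprod.snd = 0 ∧
        IsNonzeroOnSummands q.2 := by
    rintro n ⟨Y, α⟩
    obtain ⟨B, f, hf⟩ := exists_isLeftTruncation (τ (Fin.ofNat d (n + 1))) Y
    obtain ⟨Y', W, e, h0, h1⟩ := exists_iso_biprod_isNonzeroOnSummands size hadd hzero (α ≫ f)
    exact ⟨⟨Y', (α ≫ f) ≫ e.hom ≫ biprod.fst⟩, f ≫ e.hom ≫ biprod.fst, B, W, f, e, hf, rfl,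
      (Category.assoc _ _ _).symm, (Category.assoc _ _ _).symm.trans h0, h1⟩
  choose next β hβ using hstep
  obtain ⟨B, f, hf⟩ := exists_isLeftTruncation (τ 0) t
  let p (n : ℕ) : Σ Y : T, t ⟶ Y := Nat.rec ⟨B, f⟩ next n
  exact ⟨⟨fun n => (p n).1, fun n => (p n).2, fun n => β n (p n), hf, fun n => hβ n (p n)⟩⟩

theorem RefinedTruncation.comp_β {d : ℕ} [NeZero d] {τ : Fin d → TStructure T} {t : T}
    (S : RefinedTruncation τ t) (n : ℕ) : S.α n ≫ S.β n = S.α (n + 1) := by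
  obtain ⟨B, W, f, e, -, h1, h2, -⟩ := S.step n
  rw [h1, h2]

theorem RefinedTruncation.ge_one {d : ℕ} [NeZero d] {τ : Fin d → TStructure T} {t : T}
    (S : RefinedTruncation τ t) (n : ℕ) : (τ (Fin.ofNat d (n + 1))).ge 1 (S.Y (n + 1)) := by
  obtain ⟨B, W, f, e, h, -⟩ := S.step n
  exact TStructure.ge_one_of_retract _
    ⟨biprod.inl ≫ e.inv, e.hom ≫ biprod.fst, by simp⟩ h.1

/-- Discarding `W` loses nothing after composition with `α n`, whose component at `W` is zero. -/
theorem RefinedTruncation.exists_factor {d : ℕ} [NeZero d] {τ : Fin d → TStructure T} {t : T}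
    (S : RefinedTruncation τ t) {n : ℕ} {V : T} (hV : (τ (Fin.ofNat d (n + 1))).ge 1 V)
    (g : S.Y n ⟶ V) : ∃ g' : S.Y (n + 1) ⟶ V, S.α n ≫ g = S.α (n + 1) ≫ g' := by
  obtain ⟨B, W, f, e, h, -, h2, h3, -⟩ := S.step n
  obtain ⟨g', rfl⟩ := h.exists_factor hV g
  refine ⟨biprod.inl ≫ e.inv ≫ g', ?_⟩
  have htot : biprod.fst ≫ biprod.inl + biprod.snd ≫ biprod.inr = 𝟙 (S.Y (n + 1) ⊞ W) :=
    biprod.total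
  calc S.α n ≫ f ≫ g' = (S.α n ≫ f ≫ e.hom) ≫ 𝟙 _ ≫ e.inv ≫ g' := by simp
    _ = (S.α n ≫ f ≫ e.hom ≫ biprod.fst) ≫ biprod.inl ≫ e.inv ≫ g' +
        (S.α n ≫ f ≫ e.hom ≫ biprod.snd) ≫ biprod.inr ≫ e.inv ≫ g' := by
          rw [← htot]
          simp only [Preadditive.comp_add, Preadditive.add_comp, Category.assoc]
    _ = _ := by rw [h2, h3, zero_comp, add_zero]

end Decomposition

/-! ### Tube summands and divisors of basis morphisms -/

namespace StandardStableTube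

open TubeVertex

variable {k : Type w} [Field k] {T : Type u} [Category.{v} T] [Preadditive T] [Linear k T]
  [HasZeroObject T] [HasShift T ℤ] [∀ n : ℤ, (shiftFunctor T n).Additive] [Pretriangulated T]
  {ρ : ℕ} (𝒯 : StandardStableTube k T ρ)

theorem mem_of_isZero {O : T} (hO : IsZero O) : 𝒯.mem O := by
  refine ⟨0, Fin.elim0, ⟨hO.iso ?_⟩⟩
  rw [IsZero.iff_id_eq_zero]
  exact biproduct.hom_ext _ _ fun j => j.elim0

theorem mem_biprod_obj {Y : T} (hY : 𝒯.mem Y) (x : TubeVertex ρ) : 𝒯.mem (𝒯.F.obj x ⊞ Y) := by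
  obtain ⟨n, y, ⟨c⟩⟩ := hY
  let z : Fin (n + 1) → TubeVertex ρ := Fin.cons x y
  let p (j : Fin (n + 1)) : 𝒯.F.obj x ⊞ Y ⟶ 𝒯.F.obj (z j) :=
    Fin.cases (motive := fun j => 𝒯.F.obj x ⊞ Y ⟶ 𝒯.F.obj (z j)) biprod.fst
      (fun j => biprod.snd ≫ c.hom ≫ biproduct.π _ j) j
  let i (j : Fin (n + 1)) : 𝒯.F.obj (z j) ⟶ 𝒯.F.obj x ⊞ Y :=
    Fin.cases (motive := fun j => 𝒯.F.obj (z j) ⟶ 𝒯.F.obj x ⊞ Y) biprod.inl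
      (fun j => biproduct.ι (fun j => 𝒯.F.obj (y j)) j ≫ c.inv ≫ biprod.inr) j
  have hsum : ∑ j, p j ≫ i j = 𝟙 _ := by
    rw [Fin.sum_univ_succ]
    change biprod.fst ≫ biprod.inl + ∑ j, (biprod.snd ≫ c.hom ≫ biproduct.π _ j) ≫
      biproduct.ι (fun j => 𝒯.F.obj (y j)) j ≫ c.inv ≫ biprod.inr = _
    have h : ∑ j, (biprod.snd ≫ c.hom ≫ biproduct.π _ j) ≫
        biproduct.ι (fun j => 𝒯.F.obj (y j)) j ≫ c.inv ≫ (biprod.inr : Y ⟶ 𝒯.F.obj x ⊞ Y) =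
        (biprod.snd : 𝒯.F.obj x ⊞ Y ⟶ Y) ≫ c.hom ≫ (∑ j, biproduct.π _ j ≫
          biproduct.ι (fun j => 𝒯.F.obj (y j)) j) ≫ c.inv ≫ biprod.inr := by
      simp only [Preadditive.sum_comp, Preadditive.comp_sum, Category.assoc]
    rw [h, biproduct.total]
    simp
  have hpi (j j' : Fin (n + 1)) : i j ≫ p j' =
      biproduct.ι (fun j => 𝒯.F.obj (z j)) j ≫ biproduct.π _ j' := by
    cases j using Fin.cases with
    | zero =>
      cases j' using Fin.cases with
      | zero => exact biprod.inl_fst.trans (biproduct.ι_π_self (fun j => 𝒯.F.obj (z j)) 0).symm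
      | succ j' =>
        rw [biproduct.ι_π_ne _ (Fin.succ_ne_zero j').symm]
        have h : (biprod.inl : 𝒯.F.obj x ⟶ 𝒯.F.obj x ⊞ Y) ≫ biprod.snd ≫ c.hom ≫
            biproduct.π (fun j => 𝒯.F.obj (y j)) j' = 0 := by
          rw [biprod.inl_snd_assoc, zero_comp]
        exact h
    | succ j =>
      cases j' using Fin.cases with
      | zero =>
        rw [biproduct.ι_π_ne _ (Fin.succ_ne_zero j)]
        change (biproduct.ι (fun j => 𝒯.F.obj (y j)) j ≫ c.inv ≫ biprod.inr) ≫ biprod.fst = 0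
        simp
      | succ j' =>
        change (biproduct.ι (fun j => 𝒯.F.obj (y j)) j ≫ c.inv ≫ biprod.inr) ≫ biprod.snd ≫
          c.hom ≫ biproduct.π (fun j => 𝒯.F.obj (y j)) j' = _
        simp only [Category.assoc, biprod.inr_snd_assoc, Iso.inv_hom_id_assoc]
        by_cases h : j = j'
        · subst h
          rw [biproduct.ι_π_self]
          exact (biproduct.ι_π_self (fun j => 𝒯.F.obj (z j)) j.succ).symm
        · rw [biproduct.ι_π_ne _ h, biproduct.ι_π_ne _ ((Fin.succ_injective _).ne h)]
          rfl
  refine ⟨n + 1, z, ⟨⟨biproduct.lift p, biproduct.desc i, ?_, ?_⟩⟩⟩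
  · rw [biproduct.lift_desc, hsum]
  · apply biproduct.hom_ext'
    intro j
    apply biproduct.hom_ext
    intro j'
    simp [hpi]

theorem mem_of_iso {X Y : T} (e : X ≅ Y) (hY : 𝒯.mem Y) : 𝒯.mem X := by
  obtain ⟨n, y, ⟨c⟩⟩ := hY
  exact ⟨n, y, ⟨e ≪≫ c⟩⟩

/-- Given an additive size, each object has a maximal summand in the tube. -/
theorem nonempty_splitting (size : T → ℕ)
    (hadd : ∀ X Y Z : T, (X ≅ Y ⊞ Z) → size X = size Y + size Z)
    (hzero : ∀ X, size X = 0 → IsZero X) (Y : T) : Nonempty (𝒯.Splitting Y) := by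
  have key : ∀ (n : ℕ) (Y' Z : T) (e : Y ≅ Y' ⊞ Z), size Z = n → 𝒯.mem Y' →
      Nonempty (𝒯.Splitting Y) := by
    intro n
    induction n using Nat.strong_induction_on with
    | _ n ih =>
      intro Y' Z e hn hY'
      by_cases hZ : ∀ x : TubeVertex ρ, IsEmpty (Retract (𝒯.F.obj x) Z)
      · exact ⟨⟨Y', Z, e, hY', hZ⟩⟩
      · simp only [not_forall, not_isEmpty_iff] at hZ
        obtain ⟨x, ⟨r⟩⟩ := hZ
        obtain ⟨Z', c, -⟩ := exists_iso_biprod_of_section r.r r.i r.retract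
        have hsize := hadd _ _ _ c
        have hx : size (𝒯.F.obj x) ≠ 0 := fun h => 𝒯.not_isZero_obj x (hzero _ h)
        let e' : Y ≅ (𝒯.F.obj x ⊞ Y') ⊞ Z' :=
          e ≪≫ biprod.mapIso (Iso.refl Y') c ≪≫ (biprod.associator _ _ _).symm ≪≫
            biprod.mapIso (biprod.braiding _ _) (Iso.refl Z')
        exact ih (size Z') (by omega) _ _ e' rfl (𝒯.mem_biprod_obj hY' x)
  obtain ⟨O, hO⟩ := HasZeroObject.zero (C := T)
  exact key _ O Y (isoZeroBiprod hO) rfl (𝒯.mem_of_isZero hO)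

theorem exists_iso_obj {t : T} (ht : Indecomposable t) (hm : 𝒯.mem t) :
    ∃ x, Nonempty (t ≅ 𝒯.F.obj x) := by
  obtain ⟨n, x, ⟨c⟩⟩ := hm
  cases n with
  | zero =>
    refine absurd ?_ ht.1
    rw [IsZero.iff_id_eq_zero, ← cancel_mono c.hom]
    exact biproduct.hom_ext _ _ fun j => j.elim0
  | succ n =>
    refine ⟨x 0, nonempty_iso_of_indecomposable_of_retract ht
      ⟨biproduct.ι (fun j => 𝒯.F.obj (x j)) 0 ≫ c.inv, c.hom ≫ biproduct.π _ 0, ?_⟩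
      (𝒯.not_isZero_obj _)⟩
    simp

theorem comp_eq_zero_of_mem {Z W : T} (hZ : ∀ x : TubeVertex ρ, IsEmpty (Retract (𝒯.F.obj x) Z))
    (hW : 𝒯.mem W) {x : TubeVertex ρ} (f : 𝒯.F.obj x ⟶ Z) (g : Z ⟶ W) : f ≫ g = 0 := by
  obtain ⟨n, y, ⟨c⟩⟩ := hW
  rw [← cancel_mono c.hom]
  apply biproduct.hom_ext
  intro j
  simpa using 𝒯.comp_eq_zero hZ f (g ≫ c.hom ≫ biproduct.π _ j)

variable {𝒯}

namespace Splitting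

variable {Y : T} (P : 𝒯.Splitting Y)

/-- Morphisms from an object of the tube to the tube only see the summand in the tube. -/
theorem comp_eq {x : TubeVertex ρ} (α : 𝒯.F.obj x ⟶ Y) {W : T} (hW : 𝒯.mem W) (g : Y ⟶ W) :
    α ≫ g = (α ≫ P.π) ≫ P.ι ≫ g := by
  have htot : biprod.fst ≫ biprod.inl + biprod.snd ≫ biprod.inr = 𝟙 (P.Y' ⊞ P.Z) := biprod.total
  have h0 := 𝒯.comp_eq_zero_of_mem P.isEmpty_retract hW (α ≫ P.iso.hom ≫ biprod.snd)
    (biprod.inr ≫ P.iso.inv ≫ g)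
  calc α ≫ g = α ≫ P.iso.hom ≫ 𝟙 _ ≫ P.iso.inv ≫ g := by simp
    _ = (α ≫ P.π) ≫ P.ι ≫ g + (α ≫ P.iso.hom ≫ biprod.snd) ≫ biprod.inr ≫ P.iso.inv ≫ g := by
      rw [← htot, π, ι]
      simp only [Preadditive.comp_add, Preadditive.add_comp, Category.assoc]
    _ = _ := by rw [h0, add_zero]

theorem ι_π : P.ι ≫ P.π = 𝟙 _ := by simp [ι, π]

theorem isNonzeroOnSummands {t : T} {α : t ⟶ Y} (hα : IsNonzeroOnSummands α) :
    IsNonzeroOnSummands (α ≫ P.π) := by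
  intro S S' e hS h0
  refine hα S (S' ⊞ P.Z) (P.iso ≪≫ biprod.mapIso e (Iso.refl _) ≪≫ biprod.associator _ _ _) hS ?_
  rw [← h0]
  simp [π]

end Splitting

theorem mem_obj (x : TubeVertex ρ) : 𝒯.mem (𝒯.F.obj x) := by
  obtain ⟨O, hO⟩ := HasZeroObject.zero (C := T)
  exact 𝒯.mem_of_iso (isoBiprodZero hO) (𝒯.mem_biprod_obj (𝒯.mem_of_isZero hO) x)

/-- If a basis morphism is a sum of composites of morphisms in the tube, then it has a left divisor
up to an isomorphism among the first factors. -/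
theorem exists_divisor {x y : TubeVertex ρ} {a : ℕ} (h : Reach x y a) {n : ℕ}
    (z : Fin n → TubeVertex ρ) (f : ∀ j, 𝒯.F.obj x ⟶ 𝒯.F.obj (z j))
    (g : ∀ j, 𝒯.F.obj (z j) ⟶ 𝒯.F.obj y) (hfg : 𝒯.kap x y a = ∑ j, f j ≫ g j) :
    ∃ j b, Reach x (z j) b ∧ b ≤ a ∧ (z j).level + b ≤ y.level + a ∧
      ∃ u, f j ≫ u = 𝒯.kap x (z j) b := by
  obtain ⟨c, hc, hc'⟩ := 𝒯.exists_coeff h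
  obtain ⟨j, hj⟩ : ∃ j, c (f j ≫ g j) ≠ 0 := by
    by_contra! hcon
    rw [hfg, map_sum, Finset.sum_eq_zero fun j _ => hcon j] at hc
    exact zero_ne_one hc
  have hf : f j ≠ 0 := fun h0 => hj (by rw [h0, zero_comp, map_zero])
  obtain ⟨b, hb, u, hu, hfu⟩ := 𝒯.exists_eq_kap_comp hf
  rw [hfu, Category.assoc] at hj
  -- Otherwise no basis term of `u ≫ g j` could contribute to the nonzero coefficient at `a`.
  have key : ∃ e, Reach (z j) y e ∧ b + e = a := by
    by_contra! hcon
    refine hj ?_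
    have hs := 𝒯.mem_span_kap (u ≫ g j)
    generalize u ≫ g j = v at hs
    induction hs using Submodule.span_induction with
    | zero => rw [comp_zero, map_zero]
    | add v v' _ _ hv hv' => rw [Preadditive.comp_add, map_add, hv, hv', add_zero]
    | smul r v _ hv => rw [Linear.comp_smul, map_smul, hv, smul_zero]
    | mem v hv =>
      obtain ⟨e, he, rfl⟩ := hv
      rw [kap_comp _ hb he]
      exact hc' _ (hcon e he)
  obtain ⟨e, he, rfl⟩ := key
  have := he.le'
  exact ⟨j, b, hb, by omega, by omega, inv u, by rw [hfu, Category.assoc, IsIso.hom_inv_id,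
    Category.comp_id]⟩

end StandardStableTube

/-! ### Stabilisation of the tube summands -/

section Stabilisation

open TubeVertex

variable {k : Type w} [Field k] {T : Type u} [Category.{v} T] [Preadditive T] [Linear k T]
  [HasZeroObject T] [HasShift T ℤ] [∀ n : ℤ, (shiftFunctor T n).Additive] [Pretriangulated T]
  {ρ : ℕ} (𝒯 : StandardStableTube k T ρ) {d : ℕ} [NeZero d] {τ : Fin d → TStructure T} {t : T}

/-- The basis morphisms from an object of the tube which factor through the refined truncation
sequence are eventually constant. -/
theorem RefinedTruncation.exists_stable (hρ : 0 < ρ) (S : RefinedTruncation τ t)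
    (hS : ∀ n, Nonempty (𝒯.Splitting (S.Y n))) {x : TubeVertex ρ} (i : 𝒯.F.obj x ⟶ t) :
    ∃ N, ∀ n ≥ N, ∀ (y : TubeVertex ρ) (a : ℕ), Reach x y a →
      (∃ g : S.Y n ⟶ 𝒯.F.obj y, i ≫ S.α n ≫ g = 𝒯.kap x y a) →
      ∃ g : S.Y (n + 1) ⟶ 𝒯.F.obj y, i ≫ S.α (n + 1) ≫ g = 𝒯.kap x y a := by
  -- The end of a path from `x` with `a` downs and `b` ups.
  let V (a b : ℕ) : TubeVertex ρ := ⟨x.pos + a, x.level - a + b⟩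
  have hV : ∀ {a b}, a ≤ x.level → Reach x (V a b) a := fun ha =>
    ⟨rfl, ha, by change _ ≤ _ - _ + _ + _; omega⟩
  have hV' : ∀ {y : TubeVertex ρ} {a}, Reach x y a → V a (y.level + a - x.level) = y := by
    intro y a h
    have h1 := h.le
    have h2 := h.le'
    have h3 := h.pos
    obtain ⟨j, m⟩ := y
    dsimp only at h2 h3
    simp only [V, TubeVertex.mk.injEq]
    exact ⟨h3.symm, by omega⟩
  -- `P n` records membership in the `n`-th co-aisle, and `D` selects the lengths divisible by `ρ`.
  -- From column `ρ` on the level is at least `ρ`, as periodicity requires.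
  obtain ⟨N, hN⟩ := exists_stable_upper_sets x.level ρ
    (fun n a b => a ≤ x.level ∧ ∃ g : S.Y n ⟶ 𝒯.F.obj (V a b), i ≫ S.α n ≫ g = 𝒯.kap x (V a b) a)
    (fun n a b => (τ (Fin.ofNat d n)).ge 1 (𝒯.F.obj (V a b)))
    (fun a b => ∃ s, x.level - a + b = s * ρ + (ρ - 1))
    (fun h => h.1)
    (by
      rintro n a b a' b' ⟨ha, g, hg⟩ haa hbb ha'
      refine ⟨ha', g ≫ 𝒯.kap (V a b) (V a' b') (a' - a), ?_⟩
      have h1 : Reach (V a b) (V a' b') (a' - a) := by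
        refine reach_mk ?_ (by omega) (by omega)
        rw [Nat.cast_sub haa]
        ring
      rw [← Category.assoc (S.α n), ← Category.assoc, hg, 𝒯.kap_comp (hV ha) h1,
        Nat.add_sub_cancel' haa])
    (by
      rintro n a b ⟨ha, g, hg⟩
      exact ⟨ha, S.β n ≫ g, by rw [← Category.assoc (S.α n), S.comp_β, hg]⟩)
    (by
      rintro n a b ⟨ha, g, hg⟩
      obtain ⟨P⟩ := hS (n + 1)
      obtain ⟨m, z, ⟨c⟩⟩ := P.mem
      have h1 := P.comp_eq (i ≫ S.α (n + 1)) (StandardStableTube.mem_obj _) g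
      rw [Category.assoc, hg] at h1
      have h2 : 𝒯.kap x (V a b) a = ∑ j, (((i ≫ S.α (n + 1)) ≫ P.π) ≫ c.hom ≫
          biproduct.π (fun j => 𝒯.F.obj (z j)) j) ≫ biproduct.ι (fun j => 𝒯.F.obj (z j)) j ≫
            c.inv ≫ P.ι ≫ g := by
        rw [h1]
        have htot := biproduct.total (f := fun j => 𝒯.F.obj (z j))
        conv_lhs => rw [← Category.id_comp (P.ι ≫ g), ← c.hom_inv_id, ← Category.id_comp c.inv,
          ← htot]
        simp only [Preadditive.sum_comp, Preadditive.comp_sum, Category.assoc]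
      obtain ⟨j, e, he, hea, hle, u, hu⟩ := StandardStableTube.exists_divisor (hV ha) z _ _ h2
      have hz := hV' he
      refine ⟨e, hea, (z j).level + e - x.level, ?_, ⟨he.le, ?_⟩, ?_⟩
      · change _ ≤ x.level - a + b + a at hle
        omega
      · rw [hz]
        exact ⟨P.π ≫ c.hom ≫ biproduct.π (fun j => 𝒯.F.obj (z j)) j ≫ u, by
          rw [← hu]; simp only [Category.assoc]⟩
      · rw [hz]
        refine TStructure.ge_one_of_retract _ ⟨biproduct.ι (fun j => 𝒯.F.obj (z j)) j ≫ c.inv ≫ P.ι,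
          P.π ≫ c.hom ≫ biproduct.π (fun j => 𝒯.F.obj (z j)) j, ?_⟩ (S.ge_one n)
        have := P.ι_π
        simp only [Category.assoc]
        rw [reassoc_of% this, c.inv_hom_id_assoc, biproduct.ι_π_self])
    (by
      rintro n a b ⟨ha, g, hg⟩ hP
      obtain ⟨g', hg'⟩ := S.exists_factor hP g
      exact ⟨ha, g', by rw [← hg', hg]⟩)
    (by
      rintro n a b b' ha hP hb ⟨s, hs⟩
      have h1 := 𝒯.ge_one_mul_rank _ hρ (by omega) hP s
      rwa [← hs] at h1)
    (by
      intro a ha c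
      have h1 : x.level - a + c ≤ (x.level - a + c) * ρ := Nat.le_mul_of_pos_right _ hρ
      exact ⟨(x.level - a + c) * ρ + (ρ - 1) - (x.level - a), by omega, x.level - a + c, by omega⟩)
  refine ⟨N, fun n hn y a h hg => ?_⟩
  have h1 := hV' h
  rw [← h1] at hg ⊢
  exact (hN n hn _ _ ⟨h.le, hg⟩).2

theorem RefinedTruncation.exists_isIso (hρ : 0 < ρ) (S : RefinedTruncation τ t)
    (hS : ∀ n, Nonempty (𝒯.Splitting (S.Y n))) {x : TubeVertex ρ} (i : t ≅ 𝒯.F.obj x) :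
    ∃ N : ℕ, ∀ n ≥ N, ∀ (P : 𝒯.Splitting (S.Y n)) (P' : 𝒯.Splitting (S.Y (n + 1))),
      IsIso (P.ι ≫ S.β n ≫ P'.π) := by
  obtain ⟨N, hN⟩ := S.exists_stable 𝒯 hρ hS i.inv
  -- The shift by one excludes `α 0`, which need not be nonzero on all summands.
  refine ⟨N + 1, fun n hn P P' => ?_⟩
  have hα (m : ℕ) : IsNonzeroOnSummands (S.α (m + 1)) := by
    obtain ⟨B, W, f, e, -, -, -, -, h⟩ := S.step m
    exact h
  obtain ⟨n, rfl⟩ := Nat.exists_eq_add_of_le' (show 1 ≤ n by omega)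
  let φ := P.ι ≫ S.β (n + 1) ≫ P'.π
  have hφ : (S.α (n + 1) ≫ P.π) ≫ φ = S.α (n + 1 + 1) ≫ P'.π := by
    rw [← cancel_epi i.inv, ← S.comp_β (n + 1), Category.assoc (S.α (n + 1)) _ P'.π,
      ← Category.assoc i.inv (S.α (n + 1)), P.comp_eq _ P'.mem]
    simp only [φ, Category.assoc]
  -- Each nonzero component is a basis morphism up to an automorphism, so stability factors it
  -- through the next stage.
  obtain ⟨g, hg⟩ : ∃ g : S.Y (n + 1 + 1) ⟶ P.Y',
      S.α (n + 1) ≫ P.π = S.α (n + 1 + 1) ≫ g := by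
    obtain ⟨m, z, ⟨c⟩⟩ := P.mem
    have hcomp (j : Fin m) : ∃ g : S.Y (n + 1 + 1) ⟶ 𝒯.F.obj (z j),
        i.inv ≫ S.α (n + 1) ≫ P.π ≫ c.hom ≫ biproduct.π (fun j => 𝒯.F.obj (z j)) j =
          i.inv ≫ S.α (n + 1 + 1) ≫ g := by
      by_cases h0 : i.inv ≫ S.α (n + 1) ≫ P.π ≫ c.hom ≫
          biproduct.π (fun j => 𝒯.F.obj (z j)) j = 0
      · exact ⟨0, by rw [h0, comp_zero, comp_zero]⟩
      · obtain ⟨a, ha, u, hu, h1⟩ := 𝒯.exists_eq_kap_comp h0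
        obtain ⟨g, hg⟩ := hN (n + 1) (by omega) _ a ha
          ⟨P.π ≫ c.hom ≫ biproduct.π (fun j => 𝒯.F.obj (z j)) j ≫ inv u, by
            have h2 := congrArg (· ≫ inv u) h1
            simpa using h2⟩
        exact ⟨g ≫ u, by rw [h1, ← hg]; simp only [Category.assoc]⟩
    choose g hg using hcomp
    refine ⟨biproduct.lift g ≫ c.inv, ?_⟩
    rw [← cancel_epi i.inv, ← cancel_mono c.hom]
    apply biproduct.hom_ext
    intro j
    simpa using hg j
  have hψ : (S.α (n + 1 + 1) ≫ P'.π) ≫ P'.ι ≫ g = S.α (n + 1) ≫ P.π := by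
    rw [hg, ← cancel_epi i.inv, ← Category.assoc i.inv (S.α (n + 1 + 1)) g,
      P'.comp_eq (i.inv ≫ S.α (n + 1 + 1)) P.mem g]
    simp only [Category.assoc]
  have h1 : IsIso (φ ≫ P'.ι ≫ g) :=
    𝒯.isIso_of_isNonzeroOnSummands P.mem (P.isNonzeroOnSummands (hα n)) (by
      rw [← Category.assoc, hφ, hψ])
  have h2 : IsIso ((P'.ι ≫ g) ≫ φ) :=
    𝒯.isIso_of_isNonzeroOnSummands P'.mem (P'.isNonzeroOnSummands (hα (n + 1))) (by
      rw [← Category.assoc, hψ, hφ])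
  change IsIso φ
  have hm : IsSplitMono φ := ⟨⟨⟨(P'.ι ≫ g) ≫ inv (φ ≫ P'.ι ≫ g), by
    rw [← Category.assoc, IsIso.hom_inv_id]⟩⟩⟩
  have he : IsSplitEpi φ := ⟨⟨⟨inv ((P'.ι ≫ g) ≫ φ) ≫ P'.ι ≫ g, by
    rw [Category.assoc, IsIso.inv_hom_id]⟩⟩⟩
  exact isIso_of_mono_of_isSplitEpi φ

end Stabilisation

theorem proposition6p13
    {k : Type w} [Field k] [IsAlgClosed k]
    {T : Type u} [Category.{v} T] [Preadditive T] [Linear k T] [HasZeroObject T] [HasShift T ℤ]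
    [∀ n : ℤ, (shiftFunctor T n).Additive] [∀ n : ℤ, (shiftFunctor T n).Linear k]
    [Pretriangulated T] [IsTriangulated T]
    (hT : IsPiecewiseTameHereditary k T)
    {d : ℕ} [NeZero d] (τ : Fin d → TStructure T)
    {ρ : ℕ} (hρ : 1 < ρ) (𝒯 : StandardStableTube k T ρ)
    (t : T) (ht : Indecomposable t) (htT : 𝒯.mem t) :
    Nonempty (RefinedTruncation τ t) ∧
    ∀ S : RefinedTruncation τ t,
      (∀ n, Nonempty (𝒯.Splitting (S.Y n))) ∧
      ∃ N : ℕ, ∀ n ≥ N, ∀ (P : 𝒯.Splitting (S.Y n)) (P' : 𝒯.Splitting (S.Y (n + 1))),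
        IsIso (P.ι ≫ S.β n ≫ P'.π) := by
  obtain ⟨size, hadd, hzero⟩ := hT.exists_size
  obtain ⟨x, ⟨i⟩⟩ := 𝒯.exists_iso_obj ht htT
  refine ⟨RefinedTruncation.nonempty size hadd hzero τ t, fun S => ?_⟩
  have hS (n : ℕ) : Nonempty (𝒯.Splitting (S.Y n)) :=
    𝒯.nonempty_splitting size hadd hzero _
  exact ⟨hS, S.exists_isIso 𝒯 (by omega) hS i⟩
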